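/- **Setting.** Let $V=\{v_1,\dots,v_n\}$ be the vertices of a directed acyclic graph $G=(V,E)$ without multiple edges. Let $d_i$ be the out-degree of $v_i$, let $m=|E|=\sum_i d_i$, let $L$ be the set of sinks (vertices with $d_i=0$), and let $\hat n=n-|L|\ge 1$. The graph is given in the adjacency list model: the out-degrees $d_1,\dots,d_n$ are known, and the input consists of the arrays $D_i$ ($1\le i\le n$) of the $d_i$ distinct out-neighbours of $v_i$ together with the values of the sinks. The value set $\Sigma$ is $\mathbb R$ or $\{0,\dots,\mathcal Z\}$ with $\mathcal Z\ge 1$ (more generally, any linearly ordered set with a commutative group structure, whose addition serves only to write query answers into registers, and with a distinguished element $1$). A dynamic programming problem $P$ with transitions $h_i\in\{\mathrm{AND},\mathrm{OR},\mathrm{NAND},\mathrm{MAX},\mathrm{MIN}\}$ at the non-sink vertices asks for the values at the non-sink vertices of the function $f:V\to\Sigma$ determined by: $f(v_i)$ is the given value if $v_i\in L$, and $f(v_i)=h_i(f(u_1),\dots,f(u_{d_i}))$ with $(u_1,\dots,u_{d_i})=D_i$ if $v_i\notin L$. Here the Boolean functions have the results $0$ and $1$; an argument counts as false if it is $0$ and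 as true otherwise. Quantum algorithms are those of the query model: from a fixed basis state, unitaries that do not depend on the input $x$ alternate with the query transformation $|q\rangle|z\rangle|w\rangle\mapsto|q\rangle|z+x_q\rangle|w\rangle$ (which may be skipped in branches marked by an empty index register), followed by a measurement in the computational basis. One query yields one entry of an array $D_i$ or the value of one sink. The running time is the number of queries. **Lemma.** There is an absolute constant $C>0$ such that for all $n$, all $d_1,\dots,d_n$ with $\hat n\ge 1$, all $\Sigma$ and all transitions $h_i\in\{\mathrm{AND},\mathrm{OR},\mathrm{NAND},\mathrm{MAX},\mathrm{MIN}\}$ there is a quantum algorithm $A$, which depends only on these data (and has a finite-dimensional work-space if $\Sigma$ is finite), with the following two properties. 1. Its running time is at most $C\sqrt{\hat n m}\,\log\hat n$, and also at most $C\sqrt{nm}\,\log n$. 2. For every directed acyclic graph with these out-degrees and all values of its sinks, the probability that the output of $A$ is not the table of the correct values $f(v_i)$ for all $v_i\in V\setminus L$ is at most $C/\hat n$. -/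

import Mathlib

open scoped lp

noncomputable section

/-! ### Quantum query algorithms -/

/-- The permutation unitary of `ℓ²(B)` which sends the basis vector `|b⟩` to `|e b⟩`. -/
def permUnitary {B : Type} (e : B ≃ B) : ℓ²(B, ℂ) ≃ₗᵢ[ℂ] ℓ²(B, ℂ) where
  toFun ψ := ⟨fun b => ψ (e.symm b), by
    have h := (memℓp_gen_iff (p := 2) (by norm_num)).1 (lp.memℓp ψ)
    exact (memℓp_gen_iff (p := 2) (by norm_num)).2 (e.symm.summable_iff.2 h)⟩
  invFun ψ := ⟨fun b => ψ (e b), by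
    have h := (memℓp_gen_iff (p := 2) (by norm_num)).1 (lp.memℓp ψ)
    exact (memℓp_gen_iff (p := 2) (by norm_num)).2 (e.summable_iff.2 h)⟩
  map_add' _ _ := rfl
  map_smul' _ _ := rfl
  left_inv ψ := by
    apply lp.ext
    funext b
    exact congrArg (ψ : B → ℂ) (e.symm_apply_apply b)
  right_inv ψ := by
    apply lp.ext
    funext b
    exact congrArg (ψ : B → ℂ) (e.apply_symm_apply b)
  norm_map' ψ := by
    rw [lp.norm_eq_tsum_rpow (p := 2) (by norm_num), lp.norm_eq_tsum_rpow (p := 2) (by norm_num)]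
    congr 1
    exact e.symm.tsum_eq (fun b => ‖ψ b‖ ^ (2 : ENNReal).toReal)

/-- The permutation of basis states `|i⟩|z⟩|w⟩ ↦ |i⟩|z + x i⟩|w⟩` that a query performs. The index
register holds a position of the input, or `none`, in which case the query does nothing. -/
def queryPerm {Q R : Type} [AddGroup R] (W : Type) (x : Q → R) :
    (Option Q × R × W) ≃ (Option Q × R × W) where
  toFun b := (b.1, b.2.1 + b.1.elim 0 x, b.2.2)
  invFun b := (b.1, b.2.1 - b.1.elim 0 x, b.2.2)
  left_inv b := by simp
  right_inv b := by simp

/-- A quantum query algorithm for inputs `x : Q → R` with outcomes in `O`. It starts in a basis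
state, alternates input-independent unitaries with queries to `x`, and measures in the
computational basis at the end; the outcome is read off from the measured basis state. The
registers are an index register, an answer register with contents in the group `R` and an
auxiliary work-space with computational basis `Work`. -/
structure QueryAlgorithm (Q R O : Type) [AddGroup R] where
  /-- Basis states of the auxiliary work-space. -/
  Work : Type
  /-- Contents of the work-space at the start. -/
  init : Work
  /-- Number of queries: the running time. -/
  queries : ℕ
  /-- `unitary 0` comes before the first query, `unitary t` comes after the `t`-th query. -/
  unitary : ℕ → (ℓ²(Option Q × R × Work, ℂ) ≃ₗᵢ[ℂ] ℓ²(Option Q × R × Work, ℂ))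
  /-- The outcome that belongs to a measured basis state. -/
  output : Option Q × R × Work → O

namespace QueryAlgorithm

variable {Q R O : Type} [AddGroup R] (A : QueryAlgorithm Q R O)

open Classical in
/-- The state on input `x` after `t` queries and the unitary that follows them. -/
def state (x : Q → R) : ℕ → ℓ²(Option Q × R × A.Work, ℂ)
  | 0 => A.unitary 0 (lp.single 2 (none, 0, A.init) 1)
  | t + 1 => A.unitary (t + 1) (permUnitary (queryPerm A.Work x) (state x t))

open Classical in
/-- The probability that the final measurement on input `x` gives an outcome satisfying `p`. -/
def prob (x : Q → R) (p : O → Prop) : ℝ :=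
  ∑' b : Option Q × R × A.Work, if p (A.output b) then ‖A.state x A.queries b‖ ^ 2 else 0

end QueryAlgorithm

/-! ### Dynamic programming on directed acyclic graphs -/

/-- The transition functions. -/
inductive Gate
  | and
  | or
  | nand
  | max
  | min

open Classical in
/-- The value of a transition function at a non-empty list of arguments. The Boolean functions
regard `0` as false, everything else as true, and return `0` or `1`. Values may be taken in any
linear order, such as `ℝ` or `Fin (Z + 1)`, that is, `{0, …, Z}`. -/
def Gate.eval {α : Type} [LinearOrder α] [Zero α] [One α] {k : ℕ} (hk : 0 < k) (v : Fin k → α) :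
    Gate → α
  | .and => if ∃ j, v j = 0 then 0 else 1
  | .or => if ∃ j, v j ≠ 0 then 1 else 0
  | .nand => if ∃ j, v j = 0 then 1 else 0
  | .max => Finset.univ.sup' ⟨⟨0, hk⟩, Finset.mem_univ _⟩ v
  | .min => Finset.univ.inf' ⟨⟨0, hk⟩, Finset.mem_univ _⟩ v

/-- The number `n̂` of non-sink vertices, for the out-degree sequence `d`. -/
def numNonSinks {n : ℕ} (d : Fin n → ℕ) : ℕ := (Finset.univ.filter fun i => 0 < d i).card

/-- The number `m` of edges, for the out-degree sequence `d`; see `DagInput.ncard_edges`. -/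
def numEdges {n : ℕ} (d : Fin n → ℕ) : ℕ := ∑ i, d i

/-- An input: a directed acyclic graph on the vertices `0, …, n - 1` with out-degrees `d`, given by
the arrays of the out-neighbours of its vertices, and the values at its sinks. -/
structure DagInput {n : ℕ} (d : Fin n → ℕ) (α : Type) where
  /-- The array of the out-neighbours of a vertex. -/
  nbr : ∀ i, Fin (d i) → Fin n
  nbr_injective : ∀ i, Function.Injective (nbr i)
  acyclic : ∀ i, ¬ Relation.TransGen (fun u v => ∃ k, nbr u k = v) i i
  /-- The value at a sink. -/
  sinkVal : {i // d i = 0} → α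

namespace DagInput

variable {n : ℕ} {d : Fin n → ℕ} {α : Type}

/-- The edge set. -/
def edges (x : DagInput d α) : Set (Fin n × Fin n) := {e | ∃ k, x.nbr e.1 k = e.2}

theorem ncard_edges (x : DagInput d α) : x.edges.ncard = numEdges d := by
  have h : x.edges = Set.range (fun p : (Σ i, Fin (d i)) => (p.1, x.nbr p.1 p.2)) := by
    ext ⟨u, v⟩
    simp [edges]
  have hinj : Function.Injective (fun p : (Σ i, Fin (d i)) => (p.1, x.nbr p.1 p.2)) := by
    rintro ⟨i, k⟩ ⟨j, l⟩ hp
    obtain ⟨h1, h2⟩ := Prod.mk.inj hp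
    change i = j at h1
    subst h1
    rw [show k = l from x.nbr_injective i h2]
  rw [h, ← Set.image_univ, Set.ncard_image_of_injective _ hinj, Set.ncard_univ]
  simp [numEdges]

/-- `f` is the function on the vertices that the dynamic programming recursion with the transition
functions `h` computes. -/
def IsDPFunction [LinearOrder α] [Zero α] [One α] (x : DagInput d α) (h : Fin n → Gate)
    (f : Fin n → α) : Prop :=
  (∀ s : {i // d i = 0}, f s = x.sinkVal s) ∧
    ∀ i (hi : 0 < d i), f i = (h i).eval hi (fun k => f (x.nbr i k))

/-- The recursion determines a function on the vertices. -/
theorem existsUnique_isDPFunction [LinearOrder α] [Zero α] [One α] (x : DagInput d α)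
    (h : Fin n → Gate) : ∃! f, x.IsDPFunction h f := by
  let r : Fin n → Fin n → Prop := Relation.TransGen (fun v u => ∃ k, x.nbr u k = v)
  have hirr : Std.Irrefl r := ⟨fun i hi => x.acyclic i (by
    have := Relation.transGen_swap.1 hi
    exact this)⟩
  have htr : IsTrans (Fin n) r := ⟨fun _ _ _ => Relation.TransGen.trans⟩
  have hwf : WellFounded r := Finite.wellFounded_of_trans_of_irrefl r
  have hnb : ∀ i k, r (x.nbr i k) i := fun i k => Relation.TransGen.single ⟨k, rfl⟩
  let F : ∀ i, (∀ j, r j i → α) → α := fun i g =>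
    if hi : 0 < d i then (h i).eval hi (fun k => g (x.nbr i k) (hnb i k))
    else x.sinkVal ⟨i, by omega⟩
  refine ⟨hwf.fix F, ⟨fun s => ?_, fun i hi => ?_⟩, fun g hg => ?_⟩
  · rw [hwf.fix_eq]
    simp [F, s.2]
  · rw [hwf.fix_eq]
    simp only [F, dif_pos hi]
  · funext i
    induction i using hwf.induction with
    | _ i ih =>
      rw [hwf.fix_eq]
      by_cases hi : 0 < d i
      · simp only [F, dif_pos hi]
        rw [hg.2 i hi]
        congr 1
        funext k
        exact ih _ (hnb i k)
      · simp only [F, dif_neg hi]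
        exact hg.1 ⟨i, by omega⟩

end DagInput

/-- The positions of an input that can be queried: the entries of the arrays of out-neighbours and
the values at the sinks. -/
abbrev DagQuery {n : ℕ} (d : Fin n → ℕ) : Type := (Σ i, Fin (d i)) ⊕ {i // d i = 0}

/-- The answer to a query. An answer register holds a vertex and a value; a query of an array adds
the neighbour to the former, a query of a sink adds the value at the sink to the latter. -/
def DagInput.oracle {n : ℕ} [NeZero n] {d : Fin n → ℕ} {α : Type} [AddCommGroup α]
    (x : DagInput d α) : DagQuery d → Fin n × α
  | .inl p => (x.nbr p.1 p.2, 0)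
  | .inr s => (0, x.sinkVal s)

end

/-!
The algorithm is a depth-first search in which every scan of an adjacency list is a quantum
search, so that a topological order of the graph is found while the values are computed. When the
search comes to a non-sink `v`, it looks for an unvisited non-sink among the out-neighbours of `v`
and, if there is one, continues there. Otherwise the values at all out-neighbours of `v` are
known, or can be queried at sinks, since by acyclicity no out-neighbour of `v` can still be on the
stack (`DagInput.SearchInvariant.table_nbr`); then the transition function of `v` is evaluated.
All transition functions are functions of a maximum in some linear order
(`Gate.exists_eval_eq_sup'`), so it suffices to find maxima.

The quantum part is a Grover search with a prescribed number of iterations, which makes the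
initial angle `θ` between the uniform superposition and the unmarked items grow to `3 ^ j * θ`
(`Grover.ev_attempt`). An unknown number of marked items is dealt with by trying the levels `j =
0, 1, …` one after the other: some level brings the angle into `[π / 6, π / 2]`, where a marked
item is found with a probability of at least `1 / 4`. With `L` of order `log n̂`, repeating every
level `O(L)` times finds one of `t` marked items among `d` items with `O(L √(d / t))` queries, up
to an exponentially small probability (`Grover.ev_search_searchSchedule_le`). The maximum is found
by repeated searches for items above the largest key found so far. As the outcome is uniform among
those, a search of the suitable level reduces their number by a factor `9`, hence the angle by a
factor `3`, with a probability of at least `1 / 36`. The lower a level, the cheaper it is, so it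
is repeated more often, and the total cost is `O(L √d)` (`Grover.ev_maxLoop_le`).

The total cost is bounded by a potential (`DagInput.potential`). Put `l = √(m / n̂)`. A successful
search with `t` marked items at a vertex with out-degree `d` costs `L √(d / t)` up to a constant.
It costs at most `l L`, which sums up to `n̂ l L`, or else `t` is less than `d / l ^ 2`; since `t`
decreases from one search at a vertex to the next, the latter searches cost at most `L ∑_{t ≤ d /
l ^ 2} √(d / t) ≤ 2 L d / l` at this vertex, which sums up to `2 m L / l`. The last search at a
vertex and the evaluation cost `O(L √d)`, and `∑ √dᵢ ≤ √(n̂ m)`. Altogether the cost is `O(L √(n̂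
m))`. There are `2 n̂` steps, and each of them fails with probability `O(2 ^ (-L)) = O(n̂ ^
(-2))`.

In order to obtain a single query algorithm with a fixed number of queries, intermediate
measurements are deferred (`QueryAlgorithm.ev_bind`), and a program with a variable running time
is aborted when it exceeds its budget (`Prog.exists_queryAlgorithm`).
-/

noncomputable section

/-! ### Square-summable functions -/

section SquareSummable

variable {B : Type}

theorem memlp_two_iff_tsum_enorm {f : B → ℂ} :
    Memℓp f 2 ↔ ∑' b, ‖f b‖ₑ ^ 2 ≠ ⊤ := by
  rw [memℓp_gen_iff (by norm_num)]
  have h := ENNReal.tsum_coe_ne_top_iff_summable_coe (f := fun b => ‖f b‖₊ ^ 2)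
  simp only [ENNReal.coe_pow, NNReal.coe_pow, coe_nnnorm] at h
  simpa [enorm_eq_nnnorm] using h.symm

theorem enorm_sq_eq_tsum (ψ : ℓ²(B, ℂ)) : ‖ψ‖ₑ ^ 2 = ∑' b, ‖ψ b‖ₑ ^ 2 := by
  have h := lp.hasSum_norm (p := 2) (by norm_num) ψ
  simp only [ENNReal.toReal_ofNat, Real.rpow_ofNat] at h
  have h' := ENNReal.ofReal_tsum_of_nonneg (fun b => sq_nonneg ‖ψ b‖) h.summable
  rw [h.tsum_eq] at h'
  simpa [ENNReal.ofReal_pow] using h'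

theorem enorm_map_isometryEquiv {C : Type} (U : ℓ²(B, ℂ) ≃ₗᵢ[ℂ] ℓ²(C, ℂ)) (ψ : ℓ²(B, ℂ)) :
    ‖U ψ‖ₑ = ‖ψ‖ₑ := by
  rw [← ofReal_norm, ← ofReal_norm, U.norm_map]

open Classical in
/-- The computational basis vector `|b⟩`. -/
def ket (b : B) : ℓ²(B, ℂ) := lp.single 2 b 1

open Classical in
theorem ket_apply (b c : B) : ket b c = if c = b then 1 else 0 := by
  simp [ket, lp.single_apply, Pi.single_apply]

theorem ket_apply_self (b : B) : ket b b = 1 := by simp [ket_apply]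

theorem ket_apply_of_ne {b c : B} (h : c ≠ b) : ket b c = 0 := by simp [ket_apply, h]

theorem norm_ket (b : B) : ‖ket b‖ = 1 := by
  simp [ket]

@[simp]
theorem permUnitary_apply (e : B ≃ B) (ψ : ℓ²(B, ℂ)) (b : B) :
    permUnitary e ψ b = ψ (e.symm b) := rfl

theorem permUnitary_ket (e : B ≃ B) (b : B) : permUnitary e (ket b) = ket (e b) := by
  apply lp.ext
  funext c
  rw [permUnitary_apply, ket_apply, ket_apply]
  by_cases h : c = e b
  · simp [h]
  · rw [if_neg h, if_neg (fun h' => h (by rw [← h', e.apply_symm_apply]))]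

end SquareSummable

/-! ### Block-diagonal unitaries -/

section Block

variable {B ι : Type} {F : ι → Type}

/-- The restriction of a vector to the `i`-th block, for a decomposition `e` of the basis. -/
def blockSlice (e : B ≃ Σ i, F i) (i : ι) : ℓ²(B, ℂ) →ₗ[ℂ] ℓ²(F i, ℂ) where
  toFun ψ := ⟨fun w => ψ (e.symm ⟨i, w⟩), by
    have h := memlp_two_iff_tsum_enorm.1 (lp.memℓp ψ)
    refine memlp_two_iff_tsum_enorm.2 (ne_top_of_le_ne_top h ?_)
    exact ENNReal.tsum_comp_le_tsum_of_injective
      (f := fun w : F i => e.symm ⟨i, w⟩) (fun w w' hw => by simpa using hw) (fun b => ‖ψ b‖ₑ ^ 2)⟩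
  map_add' _ _ := rfl
  map_smul' _ _ := rfl

theorem tsum_enorm_blockSlice (e : B ≃ Σ i, F i) (ψ : ℓ²(B, ℂ)) :
    ∑' i, ‖blockSlice e i ψ‖ₑ ^ 2 = ‖ψ‖ₑ ^ 2 := by
  have h : ∀ i, ‖blockSlice e i ψ‖ₑ ^ 2 = ∑' w, ‖ψ (e.symm ⟨i, w⟩)‖ₑ ^ 2 :=
    fun i => enorm_sq_eq_tsum _
  rw [tsum_congr h, ← ENNReal.tsum_sigma' (fun p : Σ i, F i => ‖ψ (e.symm p)‖ₑ ^ 2),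
    enorm_sq_eq_tsum]
  exact e.symm.tsum_eq (fun b => ‖ψ b‖ₑ ^ 2)

theorem blockSlice_ext (e : B ≃ Σ i, F i) {ψ φ : ℓ²(B, ℂ)}
    (h : ∀ i, blockSlice e i ψ = blockSlice e i φ) : ψ = φ := by
  apply lp.ext
  funext b
  obtain ⟨⟨i, w⟩, rfl⟩ := e.symm.surjective b
  exact congrArg (fun χ : ℓ²(F i, ℂ) => χ w) (h i)

theorem tsum_enorm_block (e : B ≃ Σ i, F i) (U : ∀ i, ℓ²(F i, ℂ) ≃ₗᵢ[ℂ] ℓ²(F i, ℂ))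
    (ψ : ℓ²(B, ℂ)) :
    ∑' b, ‖U (e b).1 (blockSlice e (e b).1 ψ) (e b).2‖ₑ ^ 2 = ‖ψ‖ₑ ^ 2 := by
  have h : ∀ i, ∑' w, ‖U i (blockSlice e i ψ) w‖ₑ ^ 2 = ‖blockSlice e i ψ‖ₑ ^ 2 := fun i => by
    rw [← enorm_map_isometryEquiv (U i), enorm_sq_eq_tsum]
  rw [e.tsum_eq (fun p : Σ i, F i => ‖U p.1 (blockSlice e p.1 ψ) p.2‖ₑ ^ 2), ENNReal.tsum_sigma',
    ← tsum_enorm_blockSlice e]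
  exact tsum_congr h

/-- The vector whose `i`-th block is the image of the `i`-th block of `ψ` under `U i`. -/
def blockFun (e : B ≃ Σ i, F i) (U : ∀ i, ℓ²(F i, ℂ) ≃ₗᵢ[ℂ] ℓ²(F i, ℂ)) (ψ : ℓ²(B, ℂ)) :
    ℓ²(B, ℂ) :=
  ⟨fun b => U (e b).1 (blockSlice e (e b).1 ψ) (e b).2, memlp_two_iff_tsum_enorm.2 (by
    rw [tsum_enorm_block]
    simp)⟩

theorem blockSlice_blockFun (e : B ≃ Σ i, F i) (U : ∀ i, ℓ²(F i, ℂ) ≃ₗᵢ[ℂ] ℓ²(F i, ℂ))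
    (ψ : ℓ²(B, ℂ)) (i : ι) : blockSlice e i (blockFun e U ψ) = U i (blockSlice e i ψ) := by
  apply lp.ext
  funext w
  have key : ∀ p : Σ i, F i, p = ⟨i, w⟩ →
      U p.1 (blockSlice e p.1 ψ) p.2 = U i (blockSlice e i ψ) w := by
    rintro _ rfl
    rfl
  exact key _ (e.apply_symm_apply _)

/-- The unitary which acts on the `i`-th block as `U i`. -/
def blockUnitary (e : B ≃ Σ i, F i) (U : ∀ i, ℓ²(F i, ℂ) ≃ₗᵢ[ℂ] ℓ²(F i, ℂ)) :
    ℓ²(B, ℂ) ≃ₗᵢ[ℂ] ℓ²(B, ℂ) where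
  toFun := blockFun e U
  invFun := blockFun e fun i => (U i).symm
  map_add' ψ φ := blockSlice_ext e fun i => by
    simp only [blockSlice_blockFun, map_add]
  map_smul' c ψ := blockSlice_ext e fun i => by
    simp only [blockSlice_blockFun, map_smul, RingHom.id_apply]
  left_inv ψ := blockSlice_ext e fun i => by
    simp only [blockSlice_blockFun, LinearIsometryEquiv.symm_apply_apply]
  right_inv ψ := blockSlice_ext e fun i => by
    simp only [blockSlice_blockFun, LinearIsometryEquiv.apply_symm_apply]
  norm_map' ψ := by
    change ‖blockFun e U ψ‖ = ‖ψ‖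
    have h : ‖blockFun e U ψ‖ₑ ^ 2 = ‖ψ‖ₑ ^ 2 := by
      rw [enorm_sq_eq_tsum]
      exact tsum_enorm_block e U ψ
    have h2 : ‖blockFun e U ψ‖ₑ = ‖ψ‖ₑ := by
      exact (ENNReal.pow_right_strictMono two_ne_zero).injective h
    rw [← toReal_enorm, ← toReal_enorm, h2]

@[simp]
theorem blockSlice_blockUnitary (e : B ≃ Σ i, F i) (U : ∀ i, ℓ²(F i, ℂ) ≃ₗᵢ[ℂ] ℓ²(F i, ℂ))
    (ψ : ℓ²(B, ℂ)) (i : ι) :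
    blockSlice e i (blockUnitary e U ψ) = U i (blockSlice e i ψ) :=
  blockSlice_blockFun e U ψ i

end Block

/-! ### Expectations of outcomes -/

namespace QueryAlgorithm

variable {Q R O Y : Type} [AddGroup R]

/-- The expectation of `g` at the outcome of the algorithm on input `x`. -/
def ev (A : QueryAlgorithm Q R O) (x : Q → R) (g : O → ENNReal) : ENNReal :=
  ∑' b, ‖A.state x A.queries b‖ₑ ^ 2 * g (A.output b)

theorem state_zero (A : QueryAlgorithm Q R O) (x : Q → R) :
    A.state x 0 = A.unitary 0 (ket (none, 0, A.init)) := by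
  unfold state ket
  congr!

theorem state_succ (A : QueryAlgorithm Q R O) (x : Q → R) (t : ℕ) :
    A.state x (t + 1) = A.unitary (t + 1) (permUnitary (queryPerm A.Work x) (A.state x t)) := rfl

theorem enorm_state (A : QueryAlgorithm Q R O) (x : Q → R) (t : ℕ) : ‖A.state x t‖ₑ = 1 := by
  induction t with
  | zero =>
    rw [state_zero, enorm_map_isometryEquiv, ← ofReal_norm, norm_ket]
    simp
  | succ t ih => rw [state_succ, enorm_map_isometryEquiv, enorm_map_isometryEquiv, ih]

theorem ev_const (A : QueryAlgorithm Q R O) (x : Q → R) (c : ENNReal) :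
    A.ev x (fun _ => c) = c := by
  rw [ev, ENNReal.tsum_mul_right, ← enorm_sq_eq_tsum, enorm_state]
  simp

theorem ev_mono (A : QueryAlgorithm Q R O) (x : Q → R) {g g' : O → ENNReal} (h : ∀ o, g o ≤ g' o) :
    A.ev x g ≤ A.ev x g' :=
  ENNReal.tsum_le_tsum fun _ => mul_le_mul_right (h _) _

open Classical in
theorem prob_eq_toReal_ev (A : QueryAlgorithm Q R O) (x : Q → R) (p : O → Prop) :
    A.prob x p = (A.ev x fun o => if p o then 1 else 0).toReal := by
  rw [prob, ev, ENNReal.tsum_toReal_eq]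
  · refine tsum_congr fun b => ?_
    split_ifs <;> simp
  · intro b
    split_ifs <;> simp [ENNReal.pow_eq_top_iff]

end QueryAlgorithm

/-! ### Sequential composition of query algorithms -/

section Runs

variable {Q R : Type} [AddGroup R]

/-- The state on input `x` after `t` queries, for given unitaries and a given initial content of
the work-space. -/
def runState {W : Type} (u : ℕ → (ℓ²(Option Q × R × W, ℂ) ≃ₗᵢ[ℂ] ℓ²(Option Q × R × W, ℂ)))
    (w : W) (x : Q → R) : ℕ → ℓ²(Option Q × R × W, ℂ)
  | 0 => u 0 (ket (none, 0, w))
  | t + 1 => u (t + 1) (permUnitary (queryPerm W x) (runState u w x t))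

theorem QueryAlgorithm.state_eq_runState {O : Type} (A : QueryAlgorithm Q R O) (x : Q → R) (t : ℕ) :
    A.state x t = runState A.unitary A.init x t := by
  induction t with
  | zero => exact A.state_zero x
  | succ t ih => rw [A.state_succ, ih]; rfl

theorem runState_congr {W : Type}
    {u v : ℕ → (ℓ²(Option Q × R × W, ℂ) ≃ₗᵢ[ℂ] ℓ²(Option Q × R × W, ℂ))} (w : W) (x : Q → R) {t : ℕ}
    (h : ∀ s ≤ t, u s = v s) : runState u w x t = runState v w x t := by
  induction t with
  | zero => rw [runState, runState, h 0 le_rfl]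
  | succ t ih => rw [runState, runState, h _ le_rfl, ih fun s hs => h s (by omega)]

/-- If the unitary after the last query is followed by `V`, so is the final state. -/
theorem runState_trans {W : Type}
    {u v : ℕ → (ℓ²(Option Q × R × W, ℂ) ≃ₗᵢ[ℂ] ℓ²(Option Q × R × W, ℂ))} (w : W) (x : Q → R) {t : ℕ}
    {V : ℓ²(Option Q × R × W, ℂ) ≃ₗᵢ[ℂ] ℓ²(Option Q × R × W, ℂ)}
    (h : ∀ s < t, u s = v s) (ht : u t = (v t).trans V) :
    runState u w x t = V (runState v w x t) := by
  cases t with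
  | zero => rw [runState, runState, ht]; rfl
  | succ t =>
    rw [runState, runState, ht, runState_congr w x fun s hs => h s (by omega)]
    rfl

end Runs

section RegsSigma

variable {Q R ι : Type} {W : ι → Type}

/-- The basis states with a work-space that is a disjoint union, split into blocks. -/
def regsSigma (Q R : Type) {ι : Type} (W : ι → Type) :
    (Option Q × R × Σ i, W i) ≃ Σ i, Option Q × R × W i where
  toFun b := ⟨b.2.2.1, b.1, b.2.1, b.2.2.2⟩
  invFun p := (p.2.1, p.2.2.1, ⟨p.1, p.2.2.2⟩)
  left_inv _ := rfl
  right_inv _ := rfl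

theorem apply_eq_of_blockSlice_eq {i : ι} {ψ : ℓ²(Option Q × R × Σ i, W i, ℂ)}
    {φ : ℓ²(Option Q × R × W i, ℂ)} (h : blockSlice (regsSigma Q R W) i ψ = φ)
    (b : Option Q × R × W i) : ψ (b.1, b.2.1, ⟨i, b.2.2⟩) = φ b := by
  rw [← h]; rfl

theorem blockSlice_regsSigma_eq {i : ι} {ψ : ℓ²(Option Q × R × Σ i, W i, ℂ)}
    {φ : ℓ²(Option Q × R × W i, ℂ)} (h : ∀ q z w, ψ (q, z, ⟨i, w⟩) = φ (q, z, w)) :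
    blockSlice (regsSigma Q R W) i ψ = φ :=
  lp.ext (funext fun b => h b.1 b.2.1 b.2.2)

/-- Queries preserve the blocks. -/
theorem blockSlice_permUnitary_queryPerm [AddGroup R] (x : Q → R) (i : ι)
    (ψ : ℓ²(Option Q × R × Σ i, W i, ℂ)) :
    blockSlice (regsSigma Q R W) i (permUnitary (queryPerm _ x) ψ) =
      permUnitary (queryPerm _ x) (blockSlice (regsSigma Q R W) i ψ) := rfl

end RegsSigma

namespace QueryAlgorithm

variable {Q R O Y : Type} [AddGroup R]
variable (B : QueryAlgorithm Q R Y) (A : Y → QueryAlgorithm Q R O)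

/-- The work-spaces of the composition: the one of `B`, and for every basis state `b` of `B`, which
is remembered after the run of `B`, the one of the algorithm that the outcome at `b` selects. -/
abbrev BindWork : Option (Option Q × R × B.Work) → Type
  | none => B.Work
  | some b => (A (B.output b)).Work

/-- The initial content of the work-space of the continuation that belongs to `b`. -/
abbrev bindInit (b : Option Q × R × B.Work) : Σ i, BindWork B A i :=
  ⟨some b, (A (B.output b)).init⟩

open Classical in
/-- The exchange of the final basis states `b` of `B` with the initial basis states of the
continuations: `b` moves into the memory. -/
def handOverFun : (Option Q × R × Σ i, BindWork B A i) → (Option Q × R × Σ i, BindWork B A i)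
  | (q, z, ⟨none, w⟩) => (none, 0, bindInit B A (q, z, w))
  | (q, z, ⟨some b, w⟩) =>
    if (q, z, (⟨some b, w⟩ : Σ i, BindWork B A i)) = (none, 0, bindInit B A b) then
      (b.1, b.2.1, ⟨none, b.2.2⟩)
    else (q, z, ⟨some b, w⟩)

theorem handOverFun_none (b : Option Q × R × B.Work) :
    handOverFun B A (b.1, b.2.1, ⟨none, b.2.2⟩) = (none, 0, bindInit B A b) := rfl

theorem handOverFun_bindInit (b : Option Q × R × B.Work) :
    handOverFun B A (none, 0, bindInit B A b) = (b.1, b.2.1, ⟨none, b.2.2⟩) := by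
  rw [bindInit, handOverFun, if_pos rfl]

theorem handOverFun_of_ne {q : Option Q} {z : R} {b : Option Q × R × B.Work}
    {w : BindWork B A (some b)}
    (h : (q, z, (⟨some b, w⟩ : Σ i, BindWork B A i)) ≠ (none, 0, bindInit B A b)) :
    handOverFun B A (q, z, ⟨some b, w⟩) = (q, z, ⟨some b, w⟩) := by
  rw [handOverFun, if_neg h]

theorem handOverFun_handOverFun (b : Option Q × R × Σ i, BindWork B A i) :
    handOverFun B A (handOverFun B A b) = b := by
  obtain ⟨q, z, ⟨_ | b, w⟩⟩ := b
  · exact handOverFun_bindInit B A (q, z, w)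
  · by_cases h : (q, z, (⟨some b, w⟩ : Σ i, BindWork B A i)) = (none, 0, bindInit B A b)
    · rw [h, handOverFun_bindInit, handOverFun_none]
    · rw [handOverFun_of_ne B A h, handOverFun_of_ne B A h]

/-- `handOverFun` as a permutation. -/
def handOver : (Option Q × R × Σ i, BindWork B A i) ≃ (Option Q × R × Σ i, BindWork B A i) where
  toFun := handOverFun B A
  invFun := handOverFun B A
  left_inv := handOverFun_handOverFun B A
  right_inv := handOverFun_handOverFun B A

/-- The unitaries of `B`, acting on the block of `B`. -/
def firstUnitary (t : ℕ) : ∀ i, ℓ²(Option Q × R × BindWork B A i, ℂ) ≃ₗᵢ[ℂ]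
    ℓ²(Option Q × R × BindWork B A i, ℂ)
  | none => B.unitary t
  | some _ => .refl ℂ _

/-- The unitaries of the continuations, acting on their blocks. -/
def secondUnitary (t : ℕ) : ∀ i, ℓ²(Option Q × R × BindWork B A i, ℂ) ≃ₗᵢ[ℂ]
    ℓ²(Option Q × R × BindWork B A i, ℂ)
  | none => .refl ℂ _
  | some b => (A (B.output b)).unitary t

/-- The unitaries of the composition. -/
def bindUnitary (t : ℕ) : ℓ²(Option Q × R × Σ i, BindWork B A i, ℂ) ≃ₗᵢ[ℂ]
    ℓ²(Option Q × R × Σ i, BindWork B A i, ℂ) :=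
  if t < B.queries then blockUnitary (regsSigma Q R _) (firstUnitary B A t)
  else if t = B.queries then
    (blockUnitary (regsSigma Q R _) (firstUnitary B A t)).trans
      ((permUnitary (handOver B A)).trans (blockUnitary (regsSigma Q R _) (secondUnitary B A 0)))
  else blockUnitary (regsSigma Q R _) (secondUnitary B A (t - B.queries))

/-- The outcomes of the composition. Its final state has no component in the block of `B`, hence
the outcomes there do not matter. -/
def bindOutput : (Option Q × R × Σ i, BindWork B A i) → O
  | (_, _, ⟨none, _⟩) =>
    (A (B.output (none, 0, B.init))).output (none, 0, (A (B.output (none, 0, B.init))).init)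
  | (q, z, ⟨some b, w⟩) => (A (B.output b)).output (q, z, w)

/-- The algorithm that runs `B`, and then the algorithm selected by the outcome of `B`, for `N`
queries. The intermediate measurement is deferred: instead, the final basis state of `B` is kept. -/
def bind (N : ℕ) : QueryAlgorithm Q R O where
  Work := Σ i, BindWork B A i
  init := ⟨none, B.init⟩
  queries := B.queries + N
  unitary := bindUnitary B A
  output := bindOutput B A

variable {B A}

/-- The first phase of the composition without the hand-over. -/
abbrev firstRun (B : QueryAlgorithm Q R Y) (A : Y → QueryAlgorithm Q R O) (x : Q → R) (t : ℕ) :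
    ℓ²(Option Q × R × Σ i, BindWork B A i, ℂ) :=
  runState (fun t => blockUnitary (regsSigma Q R _) (firstUnitary B A t)) ⟨none, B.init⟩ x t

theorem blockSlice_firstRun_none (x : Q → R) (t : ℕ) :
    blockSlice (regsSigma Q R _) none (firstRun B A x t) = B.state x t := by
  rw [state_eq_runState]
  induction t with
  | zero =>
    rw [firstRun, runState, runState, blockSlice_blockUnitary]
    refine congrArg (B.unitary 0) (blockSlice_regsSigma_eq fun q z w => ?_)
    by_cases h : (q, z, w) = (none, 0, B.init)
    · obtain ⟨rfl, rfl, rfl⟩ := h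
      rw [ket_apply_self, ket_apply_self]
    · rw [ket_apply_of_ne h, ket_apply_of_ne]
      intro h'
      simp only [Prod.mk.injEq, Sigma.mk.injEq, heq_eq_eq, true_and] at h' h
      exact h h'
  | succ t ih =>
    rw [firstRun, runState, runState, blockSlice_blockUnitary, blockSlice_permUnitary_queryPerm, ih]
    rfl

theorem blockSlice_firstRun_some (x : Q → R) (t : ℕ) (b : Option Q × R × B.Work) :
    blockSlice (regsSigma Q R _) (some b) (firstRun B A x t) = 0 := by
  induction t with
  | zero =>
    rw [firstRun, runState, blockSlice_blockUnitary]
    refine Eq.trans (congrArg _ (blockSlice_regsSigma_eq (φ := 0) fun q z w => ?_)) (map_zero _)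
    refine ket_apply_of_ne fun h' => ?_
    simp only [Prod.mk.injEq, Sigma.mk.injEq, reduceCtorEq, false_and, and_false] at h'
  | succ t ih =>
    rw [firstRun, runState, blockSlice_blockUnitary, blockSlice_permUnitary_queryPerm, ih, map_zero,
      map_zero]

theorem runState_bindUnitary_queries (x : Q → R) :
    runState (bindUnitary B A) ⟨none, B.init⟩ x B.queries =
      blockUnitary (regsSigma Q R _) (secondUnitary B A 0)
        (permUnitary (handOver B A) (firstRun B A x B.queries)) := by
  refine runState_trans (V := (permUnitary (handOver B A)).trans
    (blockUnitary (regsSigma Q R _) (secondUnitary B A 0))) _ x (fun s hs => ?_) ?_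
  · rw [bindUnitary, if_pos hs]
  · rw [bindUnitary, if_neg (lt_irrefl _), if_pos rfl]

theorem bindUnitary_add_succ (t : ℕ) : bindUnitary B A (B.queries + t + 1) =
    blockUnitary (regsSigma Q R _) (secondUnitary B A (t + 1)) := by
  rw [bindUnitary, if_neg (by omega), if_neg (by omega),
    show B.queries + t + 1 - B.queries = t + 1 by omega]

theorem blockSlice_runState_bindUnitary_none (x : Q → R) (t : ℕ) :
    blockSlice (regsSigma Q R _) none
      (runState (bindUnitary B A) ⟨none, B.init⟩ x (B.queries + t)) = 0 := by
  induction t with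
  | zero =>
    rw [add_zero, runState_bindUnitary_queries, blockSlice_blockUnitary]
    refine Eq.trans (congrArg _ (blockSlice_regsSigma_eq (φ := 0) fun q z w => ?_)) (map_zero _)
    exact apply_eq_of_blockSlice_eq (blockSlice_firstRun_some x B.queries (q, z, w))
      (none, 0, (A (B.output (q, z, w))).init)
  | succ t ih =>
    rw [← add_assoc, runState, bindUnitary_add_succ, blockSlice_blockUnitary,
      blockSlice_permUnitary_queryPerm, ih, map_zero, map_zero]

/-- After the hand-over, the block of the continuation that belongs to the basis state `b` of `B`
holds its state, scaled by the final amplitude of `B` at `b`. -/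
theorem blockSlice_runState_bindUnitary_some (x : Q → R) (t : ℕ) (b : Option Q × R × B.Work) :
    blockSlice (regsSigma Q R _) (some b)
        (runState (bindUnitary B A) ⟨none, B.init⟩ x (B.queries + t)) =
      B.state x B.queries b • (A (B.output b)).state x t := by
  rw [state_eq_runState (A _)]
  induction t with
  | zero =>
    rw [add_zero, runState_bindUnitary_queries, blockSlice_blockUnitary, runState, ← map_smul]
    refine congrArg _ (blockSlice_regsSigma_eq fun q z w => ?_)
    change firstRun B A x B.queries (handOverFun B A (q, z, ⟨some b, w⟩)) =
      B.state x B.queries b * ket (none, 0, (A (B.output b)).init) (q, z, w)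
    by_cases h : (q, z, w) = (none, 0, (A (B.output b)).init)
    · obtain ⟨rfl, rfl, rfl⟩ := h
      rw [handOverFun_bindInit, ket_apply_self, mul_one]
      exact apply_eq_of_blockSlice_eq (blockSlice_firstRun_none x B.queries) b
    · rw [ket_apply_of_ne h, mul_zero, handOverFun_of_ne]
      · exact apply_eq_of_blockSlice_eq (blockSlice_firstRun_some x B.queries b) (q, z, w)
      · intro h'
        simp only [Prod.mk.injEq, Sigma.mk.injEq, heq_eq_eq, true_and] at h' h
        exact h h'
  | succ t ih =>
    rw [← add_assoc, runState, runState, bindUnitary_add_succ, blockSlice_blockUnitary,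
      blockSlice_permUnitary_queryPerm, ih, map_smul, map_smul]
    rfl

theorem ev_bind {N : ℕ} (hN : ∀ y, (A y).queries = N) (x : Q → R) (g : O → ENNReal) :
    (bind B A N).ev x g = B.ev x fun y => (A y).ev x g := by
  have h1 := blockSlice_runState_bindUnitary_none (B := B) (A := A) x N
  have h2 := blockSlice_runState_bindUnitary_some (B := B) (A := A) x N
  have hev : (bind B A N).ev x g =
      ∑' b, ‖runState (bindUnitary B A) ⟨none, B.init⟩ x (B.queries + N) b‖ₑ ^ 2 *
        g (bindOutput B A b) := by
    rw [ev, state_eq_runState]; rfl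
  generalize runState (bindUnitary B A) ⟨none, B.init⟩ x (B.queries + N) = ψ at h1 h2 hev
  have hsome : ∀ b : Option Q × R × B.Work, ∑' w : Option Q × R × (A (B.output b)).Work,
      ‖ψ (w.1, w.2.1, ⟨some b, w.2.2⟩)‖ₑ ^ 2 * g ((A (B.output b)).output w) =
      ‖B.state x B.queries b‖ₑ ^ 2 * (A (B.output b)).ev x g := by
    intro b
    rw [ev, ← ENNReal.tsum_mul_left, hN]
    refine tsum_congr fun w => ?_
    rw [apply_eq_of_blockSlice_eq (h2 b) w]
    change ‖B.state x B.queries b * (A (B.output b)).state x N w‖ₑ ^ 2 * _ = _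
    rw [enorm_mul, mul_pow, mul_assoc]
  have hnone : ∑' w : Option Q × R × B.Work,
      ‖ψ (w.1, w.2.1, ⟨none, w.2.2⟩)‖ₑ ^ 2 *
        g (bindOutput B A (w.1, w.2.1, ⟨none, w.2.2⟩)) = 0 := by
    refine ENNReal.tsum_eq_zero.2 fun w => ?_
    rw [apply_eq_of_blockSlice_eq h1 w]
    simp
  rw [hev, ← (regsSigma Q R _).symm.tsum_eq, ENNReal.tsum_sigma',
    ← (Option.some_injective _).tsum_eq]
  · exact tsum_congr hsome
  · intro i hi
    cases i with
    | none => exact absurd hnone hi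
    | some b => exact ⟨b, rfl⟩

theorem finite_work_bind [Finite Q] [Finite R] (N : ℕ) (hB : Finite B.Work)
    (hA : ∀ y, Finite (A y).Work) : Finite (bind B A N).Work := by
  have : ∀ i, Finite (BindWork B A i) := by
    rintro (_ | b)
    · exact hB
    · exact hA _
  exact inferInstanceAs (Finite (Σ i, BindWork B A i))

/-- The algorithm that makes `N` idle queries and has the outcome `o`. -/
def const (Q R : Type) {O : Type} [AddGroup R] (N : ℕ) (o : O) : QueryAlgorithm Q R O where
  Work := Unit
  init := ()
  queries := N
  unitary _ := .refl ℂ _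
  output _ := o

theorem ev_const_algorithm (N : ℕ) (o : O) (x : Q → R) (g : O → ENNReal) :
    (const Q R N o).ev x g = g o := ev_const _ x (g o)

end QueryAlgorithm

/-! ### Circuits with queries -/

section Circuits

variable {Q R W : Type} [AddGroup R]

/-- Circuits of input-independent unitaries and queries. -/
inductive Circuit (Q R W : Type)
  /-- An input-independent unitary. -/
  | gate (U : ℓ²(Option Q × R × W, ℂ) ≃ₗᵢ[ℂ] ℓ²(Option Q × R × W, ℂ))
  /-- A query. -/
  | query
  /-- The first circuit followed by the second one. -/
  | comp (c c' : Circuit Q R W)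

namespace Circuit

/-- The number of queries. -/
def depth : Circuit Q R W → ℕ
  | gate _ => 0
  | query => 1
  | comp c c' => c.depth + c'.depth

/-- The unitary that the circuit performs on input `x`. -/
def op (x : Q → R) : Circuit Q R W → (ℓ²(Option Q × R × W, ℂ) ≃ₗᵢ[ℂ] ℓ²(Option Q × R × W, ℂ))
  | gate U => U
  | query => permUnitary (queryPerm W x)
  | comp c c' => (c.op x).trans (c'.op x)

/-- The negation of the answer register. -/
def negAnswer : (Option Q × R × W) ≃ (Option Q × R × W) where
  toFun b := (b.1, -b.2.1, b.2.2)
  invFun b := (b.1, -b.2.1, b.2.2)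
  left_inv b := by simp
  right_inv b := by simp

/-- The inverse circuit. A query is inverted by conjugating it with the negation of the answer
register; this is where the group of the answers has to be commutative. -/
def inv {R : Type} [AddGroup R] : Circuit Q R W → Circuit Q R W
  | gate U => gate U.symm
  | query => comp (gate (permUnitary negAnswer)) (comp query (gate (permUnitary negAnswer)))
  | comp c c' => comp c'.inv c.inv

theorem depth_inv (c : Circuit Q R W) : c.inv.depth = c.depth := by
  induction c with
  | gate U => rfl
  | query => rfl
  | comp c c' h h' => simp only [inv, depth, h, h', add_comm]

theorem op_inv {R : Type} [AddCommGroup R] (c : Circuit Q R W) (x : Q → R) :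
    c.inv.op x = (c.op x).symm := by
  induction c with
  | gate U => rfl
  | query =>
    ext1 ψ
    apply lp.ext
    funext ⟨q, z, w⟩
    change ψ (q, -(-z - q.elim 0 x), w) = ψ (q, z + q.elim 0 x, w)
    rw [neg_sub, sub_neg_eq_add, add_comm]
  | comp c c' h h' => simp only [inv, op, h, h']; rfl

/-- The unitaries between the queries of the circuit. -/
def unitaries : Circuit Q R W → ℕ → (ℓ²(Option Q × R × W, ℂ) ≃ₗᵢ[ℂ] ℓ²(Option Q × R × W, ℂ))
  | gate U, _ => U
  | query, _ => .refl ℂ _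
  | comp c c', t =>
    if t < c.depth then c.unitaries t
    else if t = c.depth then (c.unitaries t).trans (c'.unitaries 0)
    else c'.unitaries (t - c.depth)

/-- The unitary after `t` queries for a given sequence of unitaries between the queries. -/
def seqOp (u : ℕ → (ℓ²(Option Q × R × W, ℂ) ≃ₗᵢ[ℂ] ℓ²(Option Q × R × W, ℂ))) (x : Q → R) :
    ℕ → (ℓ²(Option Q × R × W, ℂ) ≃ₗᵢ[ℂ] ℓ²(Option Q × R × W, ℂ))
  | 0 => u 0
  | t + 1 => ((seqOp u x t).trans (permUnitary (queryPerm W x))).trans (u (t + 1))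

theorem runState_eq_seqOp (u : ℕ → (ℓ²(Option Q × R × W, ℂ) ≃ₗᵢ[ℂ] ℓ²(Option Q × R × W, ℂ)))
    (x : Q → R) (w : W) (t : ℕ) : runState u w x t = seqOp u x t (ket (none, 0, w)) := by
  induction t with
  | zero => rfl
  | succ t ih => rw [runState, ih]; rfl

theorem seqOp_congr {u v : ℕ → (ℓ²(Option Q × R × W, ℂ) ≃ₗᵢ[ℂ] ℓ²(Option Q × R × W, ℂ))}
    (x : Q → R) {t : ℕ} (h : ∀ s ≤ t, u s = v s) : seqOp u x t = seqOp v x t := by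
  induction t with
  | zero => rw [seqOp, seqOp, h 0 le_rfl]
  | succ t ih => rw [seqOp, seqOp, h _ le_rfl, ih fun s hs => h s (by omega)]

theorem seqOp_unitaries (c : Circuit Q R W) (x : Q → R) :
    seqOp c.unitaries x c.depth = c.op x := by
  induction c with
  | gate U => rfl
  | query => rfl
  | comp c c' h h' =>
    have h1 : seqOp (comp c c').unitaries x c.depth = (c.op x).trans (c'.unitaries 0) := by
      rw [← h]
      cases hd : c.depth with
      | zero =>
        rw [seqOp, seqOp, unitaries, if_neg (by omega), if_pos hd.symm]
      | succ t =>
        rw [seqOp, seqOp, unitaries, if_neg (by omega), if_pos hd.symm,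
          seqOp_congr x (v := c.unitaries) fun s hs => by rw [unitaries, if_pos (by omega)]]
        rfl
    have h2 : ∀ t, seqOp (comp c c').unitaries x (c.depth + t) =
        (c.op x).trans (seqOp c'.unitaries x t) := by
      intro t
      induction t with
      | zero => exact h1
      | succ t ih =>
        rw [← add_assoc, seqOp, ih, seqOp, unitaries, if_neg (by omega), if_neg (by omega),
          show c.depth + t + 1 - c.depth = t + 1 by omega]
        rfl
    rw [depth, h2, h', op]

/-- The query algorithm that runs the circuit. -/
def toAlgorithm {O : Type} (c : Circuit Q R W) (w : W) (out : Option Q × R × W → O) :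
    QueryAlgorithm Q R O where
  Work := W
  init := w
  queries := c.depth
  unitary := c.unitaries
  output := out

theorem ev_toAlgorithm {O : Type} (c : Circuit Q R W) (w : W) (out : Option Q × R × W → O)
    (x : Q → R) (g : O → ENNReal) :
    (c.toAlgorithm w out).ev x g =
      ∑' b, ‖c.op x (ket (none, 0, w)) b‖ₑ ^ 2 * g (out b) := by
  rw [QueryAlgorithm.ev, QueryAlgorithm.state_eq_runState, runState_eq_seqOp]
  change ∑' b, ‖seqOp c.unitaries x c.depth (ket (none, 0, w)) b‖ₑ ^ 2 * g (out b) = _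
  rw [seqOp_unitaries]

/-- The `r`-fold repetition of a circuit. -/
def iterate (c : Circuit Q R W) : ℕ → Circuit Q R W
  | 0 => gate (.refl ℂ _)
  | r + 1 => comp (c.iterate r) c

theorem depth_iterate {R : Type} (c : Circuit Q R W) (r : ℕ) :
    (c.iterate r).depth = r * c.depth := by
  induction r with
  | zero => simp [iterate, depth]
  | succ r ih => simp [iterate, depth, ih, add_mul]

end Circuit

end Circuits

/-! ### Grover search -/

section Unitaries

variable {B : Type}

open Classical in
/-- The unitary that flips the sign of the basis vectors satisfying `p`. -/
def signUnitary (p : B → Prop) : ℓ²(B, ℂ) ≃ₗᵢ[ℂ] ℓ²(B, ℂ) :=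
  blockUnitary (F := fun _ : B => Unit) ⟨fun b => ⟨b, ()⟩, fun p => p.1, fun _ => rfl, fun _ => rfl⟩
    fun b => if p b then .neg ℂ else .refl ℂ _

open Classical in
theorem signUnitary_apply (p : B → Prop) (ψ : ℓ²(B, ℂ)) (b : B) :
    signUnitary p ψ b = if p b then -ψ b else ψ b := by
  change (if p b then LinearIsometryEquiv.neg ℂ else .refl ℂ _ :
    ℓ²(Unit, ℂ) ≃ₗᵢ[ℂ] ℓ²(Unit, ℂ)) _ () = _
  split_ifs <;> rfl

open Classical in
theorem signUnitary_ket (p : B → Prop) (b : B) :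
    signUnitary p (ket b) = (if p b then -1 else 1 : ℂ) • ket b := by
  apply lp.ext
  funext c
  rw [signUnitary_apply]
  change _ = (if p b then -1 else 1 : ℂ) * ket b c
  by_cases h : c = b
  · subst h
    split_ifs <;> simp
  · simp [ket_apply_of_ne h]

theorem inner_ket_left (b : B) (ψ : ℓ²(B, ℂ)) : inner ℂ (ket b) ψ = ψ b := by
  classical
  have := lp.inner_single_left (𝕜 := ℂ) (G := fun _ : B => ℂ) b (1 : ℂ) ψ
  simpa [ket] using this

/-- Any two unit vectors with a real inner product are exchanged by a reflection. -/
theorem exists_unitary_map_eq {E : Type} [NormedAddCommGroup E] [InnerProductSpace ℂ E] (v w : E)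
    (h : ‖v‖ = ‖w‖) (hr : inner ℂ v w = inner ℂ w v) : ∃ U : E ≃ₗᵢ[ℂ] E, U v = w := by
  set K : Submodule ℂ E := ℂ ∙ (v - w)
  refine ⟨Kᗮ.reflection, ?_⟩
  have h1 : Kᗮ.reflection (v - w) = -(v - w) :=
    Submodule.reflection_mem_subspace_orthogonal_precomplement_eq_neg
      (Submodule.mem_span_singleton_self _)
  have h2 : Kᗮ.reflection (v + w) = v + w := by
    refine Submodule.reflection_mem_subspace_eq_self ?_
    rw [Submodule.mem_orthogonal_singleton_iff_inner_right, inner_sub_left, inner_add_right,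
      inner_add_right, inner_self_eq_norm_sq_to_K, inner_self_eq_norm_sq_to_K, h, hr]
    ring
  have h3 : (2 : ℂ) • Kᗮ.reflection v = (2 : ℂ) • w := by
    rw [← map_smul, show (2 : ℂ) • v = (v - w) + (v + w) by rw [two_smul]; abel, map_add, h1, h2,
      two_smul]
    abel
  exact smul_right_injective E (two_ne_zero (α := ℂ)) h3

end Unitaries

namespace Grover

variable {ι Q R : Type} [AddCommGroup R] (q₁ : ι → Q) (q₂ : R → Option Q)

/-- The item with the number `k` in the input `x`: the answer to the query `q₁ k`, and the answer to
the query that `q₂` determines from the first answer (`0` if this query is skipped). -/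
def item (x : Q → R) (k : ι) : R × R := (x (q₁ k), (q₂ (x (q₁ k))).elim 0 x)

/-- The basis state with the number `k` and all other registers empty. -/
def numbered (k : ι) : Option Q × R × (ι × R) := (none, 0, (k, 0))

/-- The basis state with the number `k` and the corresponding item. -/
def loaded (x : Q → R) (k : ι) : Option Q × R × (ι × R) :=
  (q₂ (x (q₁ k)), (item q₁ q₂ x k).2, (k, (item q₁ q₂ x k).1))

theorem numbered_injective : Function.Injective (numbered (ι := ι) (Q := Q) (R := R)) := by
  intro k l h
  simpa [numbered] using h

theorem loaded_injective (x : Q → R) : Function.Injective (loaded q₁ q₂ x) := by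
  intro k l h
  simp only [loaded, Prod.mk.injEq] at h
  exact h.2.2.1

open Classical in
/-- Preparation of the first query. -/
def loadFirst : (Option Q × R × (ι × R)) ≃ (Option Q × R × (ι × R)) where
  toFun b := (Equiv.swap none (some (q₁ b.2.2.1)) b.1, b.2)
  invFun b := (Equiv.swap none (some (q₁ b.2.2.1)) b.1, b.2)
  left_inv b := by simp
  right_inv b := by simp

open Classical in
/-- Preparation of the second query. The first answer moves into the work-space, because the
answer register has to be empty. -/
def loadSecond : (Option Q × R × (ι × R)) ≃ (Option Q × R × (ι × R)) where
  toFun b := (Equiv.swap (some (q₁ b.2.2.1)) (q₂ b.2.1) b.1, b.2.2.2, (b.2.2.1, b.2.1))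
  invFun b := (Equiv.swap (some (q₁ b.2.2.1)) (q₂ b.2.2.2) b.1, b.2.2.2, (b.2.2.1, b.2.1))
  left_inv b := by simp
  right_inv b := by simp

/-- The circuit that loads the item with a given number. -/
def load : Circuit Q R (ι × R) :=
  .comp (.gate (permUnitary (loadFirst q₁)))
    (.comp .query (.comp (.gate (permUnitary (loadSecond q₁ q₂))) .query))

theorem op_load (x : Q → R) (k : ι) :
    (load q₁ q₂).op x (ket (numbered k)) = ket (loaded q₁ q₂ x k) := by
  simp only [load, Circuit.op, LinearIsometryEquiv.trans_apply, permUnitary_ket]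
  congr 1
  simp [numbered, loaded, loadFirst, loadSecond, queryPerm, item]

/-- The circuit that flips the sign of `|k⟩` if the item with the number `k` satisfies `M`. -/
def mark (M : R × R → Prop) : Circuit Q R (ι × R) :=
  .comp (load q₁ q₂) (.comp (.gate (signUnitary fun b => M (b.2.2.2, b.2.1))) (load q₁ q₂).inv)

open Classical in
theorem op_mark (M : R × R → Prop) (x : Q → R) (k : ι) :
    (mark q₁ q₂ M).op x (ket (numbered k)) =
      (if M (item q₁ q₂ x k) then -1 else 1 : ℂ) • ket (numbered k) := by
  simp only [mark, Circuit.op, LinearIsometryEquiv.trans_apply, Circuit.op_inv, op_load,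
    signUnitary_ket, map_smul]
  rw [← op_load q₁ q₂, LinearIsometryEquiv.symm_apply_apply]
  rfl

variable [Fintype ι]

/-- The vector with the amplitude `c k` at the number `k`. -/
def superposition (c : ι → ℂ) : ℓ²(Option Q × R × (ι × R), ℂ) := ∑ k, c k • ket (numbered k)

theorem inner_superposition (c c' : ι → ℂ) :
    inner ℂ (superposition (Q := Q) (R := R) c) (superposition c') =
      ∑ k, starRingEnd ℂ (c k) * c' k := by
  classical
  rw [superposition, sum_inner]
  refine Finset.sum_congr rfl fun k _ => ?_
  rw [inner_smul_left, inner_ket_left, superposition]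
  congr 1
  rw [lp.coeFn_sum, Finset.sum_apply, Finset.sum_eq_single k]
  · rw [lp.coeFn_smul, Pi.smul_apply, ket_apply_self, smul_eq_mul, mul_one]
  · intro l _ hl
    rw [lp.coeFn_smul, Pi.smul_apply, ket_apply_of_ne (numbered_injective.ne hl.symm), smul_zero]
  · simp

open Classical in
theorem op_mark_superposition (M : R × R → Prop) (x : Q → R) (c : ι → ℂ) :
    (mark q₁ q₂ M).op x (superposition c) =
      superposition fun k => if M (item q₁ q₂ x k) then -c k else c k := by
  simp only [superposition, map_sum, map_smul, op_mark, smul_smul]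
  refine Finset.sum_congr rfl fun k _ => ?_
  split_ifs <;> simp

/-- The inversion about the mean. -/
def diffusion (ι Q R : Type) [AddCommGroup R] [Fintype ι] :
    ℓ²(Option Q × R × (ι × R), ℂ) ≃ₗᵢ[ℂ] ℓ²(Option Q × R × (ι × R), ℂ) :=
  (ℂ ∙ superposition (fun _ : ι => (1 : ℂ))).reflection

theorem norm_superposition_sq (c : ι → ℂ) :
    ‖superposition (Q := Q) (R := R) c‖ ^ 2 = ∑ k, ‖c k‖ ^ 2 := by
  rw [norm_sq_eq_re_inner (𝕜 := ℂ), inner_superposition, map_sum]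
  refine Finset.sum_congr rfl fun k _ => ?_
  rw [mul_comm, Complex.mul_conj']
  norm_cast

theorem diffusion_superposition (c : ι → ℂ) :
    diffusion ι Q R (superposition c) =
      superposition fun k => 2 * (∑ l, c l) / Fintype.card ι - c k := by
  have hn : ((‖superposition (Q := Q) (R := R) fun _ : ι => (1 : ℂ)‖ : ℝ) : ℂ) ^ 2 =
      Fintype.card ι := by
    have := norm_superposition_sq (Q := Q) (R := R) fun _ : ι => (1 : ℂ)
    simp only [norm_one, one_pow, Finset.sum_const, Finset.card_univ, nsmul_eq_mul, mul_one] at this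
    exact_mod_cast this
  rw [diffusion, Submodule.reflection_singleton_apply, inner_superposition]
  erw [hn]
  simp only [superposition, map_one, one_mul, one_smul, sub_smul, Finset.sum_sub_distrib,
    ← Finset.smul_sum, two_smul, ← add_smul]
  congr 2
  ring

/-- One Grover iteration. -/
def iteration (M : R × R → Prop) : Circuit Q R (ι × R) :=
  .comp (mark q₁ q₂ M) (.gate (diffusion ι Q R))

variable [Nonempty ι]

/-- The uniform superposition can be prepared. -/
theorem exists_uniform (k₀ : ι) :
    ∃ U : ℓ²(Option Q × R × (ι × R), ℂ) ≃ₗᵢ[ℂ] ℓ²(Option Q × R × (ι × R), ℂ),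
      U (ket (numbered k₀)) = superposition fun _ : ι => (((√(Fintype.card ι))⁻¹ : ℝ) : ℂ) := by
  classical
  have hk : ket (numbered k₀) = superposition (Q := Q) (R := R) (Pi.single k₀ (1 : ℂ)) := by
    rw [superposition, Finset.sum_eq_single k₀]
    · simp
    · intro l _ hl
      simp [hl]
    · simp
  apply exists_unitary_map_eq
  · rw [← sq_eq_sq₀ (norm_nonneg _) (norm_nonneg _), norm_ket, norm_superposition_sq]
    simp
  · rw [hk, inner_superposition, inner_superposition]
    simp [Pi.single_apply]

/-- The angle whose sine is the initial amplitude of the marked items. -/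
def angle (ι : Type) [Fintype ι] (S : Finset ι) : ℝ := Real.arcsin √(S.card / Fintype.card ι)

theorem card_div_card_le_one (S : Finset ι) : (S.card : ℝ) / Fintype.card ι ≤ 1 :=
  div_le_one_of_le₀ (by exact_mod_cast Finset.card_le_univ S) (by positivity)

theorem sin_angle (S : Finset ι) : Real.sin (angle ι S) = √(S.card / Fintype.card ι) :=
  Real.sin_arcsin (by linarith [Real.sqrt_nonneg (S.card / Fintype.card ι : ℝ)])
    (Real.sqrt_le_one.2 (card_div_card_le_one S))

theorem cos_angle (S : Finset ι) :
    Real.cos (angle ι S) = √((Fintype.card ι - S.card) / Fintype.card ι) := by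
  have hd : (0 : ℝ) < Fintype.card ι := by exact_mod_cast Fintype.card_pos
  rw [angle, Real.cos_arcsin, Real.sq_sqrt (by positivity), sub_div, div_self hd.ne']

open Classical in
/-- After `r` iterations the amplitudes are constant on the marked and on the unmarked items. -/
theorem op_iterate_iteration (M : R × R → Prop) (x : Q → R) (S : Finset ι)
    (hS : ∀ k, k ∈ S ↔ M (item q₁ q₂ x k)) (r : ℕ) :
    ∃ a b : ℝ, ((iteration q₁ q₂ M).iterate r).op x
        (superposition fun _ => (((√(Fintype.card ι))⁻¹ : ℝ) : ℂ)) =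
        superposition (fun k => ((if k ∈ S then a else b : ℝ) : ℂ)) ∧
      √(S.card) * a = Real.sin ((2 * r + 1) * angle ι S) ∧
      √(Fintype.card ι - S.card) * b = Real.cos ((2 * r + 1) * angle ι S) := by
  set d : ℝ := (Fintype.card ι : ℝ) with hd
  set t : ℝ := (S.card : ℝ) with ht
  have hd0 : 0 < d := by rw [hd]; exact_mod_cast Fintype.card_pos
  have ht0 : 0 ≤ t := by positivity
  have htd : 0 ≤ d - t := by
    rw [sub_nonneg, hd, ht]
    exact_mod_cast Finset.card_le_univ S
  have hsin : Real.sin (angle ι S) = √t / √d := by rw [sin_angle, Real.sqrt_div ht0]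
  have hcos : Real.cos (angle ι S) = √(d - t) / √d := by rw [cos_angle, Real.sqrt_div htd]
  have hsd : √d ≠ 0 := (Real.sqrt_pos.2 hd0).ne'
  have hd2 : √d ^ 2 = d := Real.sq_sqrt hd0.le
  have ht2 : √t ^ 2 = t := Real.sq_sqrt ht0
  have hu2 : √(d - t) ^ 2 = d - t := Real.sq_sqrt htd
  induction r with
  | zero =>
    refine ⟨(√d)⁻¹, (√d)⁻¹, ?_, ?_, ?_⟩
    · simp only [ite_self]
      rfl
    · simp [hsin, div_eq_mul_inv]
    · simp [hcos, div_eq_mul_inv]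
  | succ r ih =>
    obtain ⟨a, b, h, ha, hb⟩ := ih
    set s : ℝ := 2 * (-(t * a) + (d - t) * b) / d with hs
    refine ⟨s + a, s - b, ?_, ?_, ?_⟩
    · rw [Circuit.iterate, Circuit.op, LinearIsometryEquiv.trans_apply, h, iteration, Circuit.op,
        LinearIsometryEquiv.trans_apply, op_mark_superposition, Circuit.op, diffusion_superposition]
      have hsum : ∑ l, (if M (item q₁ q₂ x l) then -((if l ∈ S then a else b : ℝ) : ℂ)
          else ((if l ∈ S then a else b : ℝ) : ℂ)) = ((-(t * a) + (d - t) * b : ℝ) : ℂ) := by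
        have : ∀ l, (if M (item q₁ q₂ x l) then -((if l ∈ S then a else b : ℝ) : ℂ)
            else ((if l ∈ S then a else b : ℝ) : ℂ)) =
            (((if l ∈ S then -a - b else 0) + b : ℝ) : ℂ) := by
          intro l
          simp only [← hS]
          split_ifs <;> simp
        rw [Finset.sum_congr rfl fun l _ => this l, ← Complex.ofReal_sum, Finset.sum_add_distrib,
          Finset.sum_ite_mem, Finset.univ_inter, Finset.sum_const, Finset.sum_const,
          Finset.card_univ, nsmul_eq_mul, nsmul_eq_mul]
        congr 1
        ring
      rw [hsum]
      congr 1
      funext k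
      rw [hs, hd]
      simp only [← hS]
      split_ifs <;> push_cast <;> ring
    · have : (2 * ((r + 1 : ℕ) : ℝ) + 1) * angle ι S =
          (2 * r + 1) * angle ι S + 2 * angle ι S := by push_cast; ring
      rw [this, Real.sin_add, ← ha, ← hb, Real.cos_two_mul, Real.sin_two_mul, hcos, hsin, hs]
      field_simp
      rw [hd2, hu2]
      ring
    · have : (2 * ((r + 1 : ℕ) : ℝ) + 1) * angle ι S =
          (2 * r + 1) * angle ι S + 2 * angle ι S := by push_cast; ring
      rw [this, Real.cos_add, ← ha, ← hb, Real.cos_two_mul, Real.sin_two_mul, hcos, hsin, hs]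
      field_simp
      rw [hd2, hu2]
      linear_combination (2 * √(d - t) * a * d) * ht2

/-- The circuit of `attempt`. -/
def attemptCircuit (M : R × R → Prop) (j : ℕ) : Circuit Q R (ι × R) :=
  .comp (.gate (exists_uniform (Classical.arbitrary ι)).choose)
    (.comp ((iteration q₁ q₂ M).iterate ((3 ^ j - 1) / 2)) (load q₁ q₂))

/-- The search of level `j` for an item satisfying `M`: it makes `(3 ^ j - 1) / 2` Grover
iterations, so that the initial angle is multiplied by `3 ^ j`, and returns the item with the
measured number. -/
def attempt (M : R × R → Prop) (j : ℕ) : QueryAlgorithm Q R (R × R) :=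
  (attemptCircuit q₁ q₂ M j).toAlgorithm (Classical.arbitrary ι, 0) fun b => (b.2.2.2, b.2.1)

theorem queries_attempt (M : R × R → Prop) (j : ℕ) :
    (attempt q₁ q₂ M j).queries = 2 * 3 ^ j := by
  have h : (3 ^ j - 1) / 2 * 2 = 3 ^ j - 1 :=
    Nat.div_mul_cancel (by simpa using Nat.sub_dvd_pow_sub_pow 3 1 j)
  have h1 : 1 ≤ 3 ^ j := Nat.one_le_pow _ _ (by norm_num)
  change (attemptCircuit q₁ q₂ M j).depth = _
  simp only [attemptCircuit, Circuit.depth, Circuit.depth_iterate, iteration, mark, load,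
    Circuit.depth_inv]
  omega

theorem finite_work_attempt [Finite R] (M : R × R → Prop) (j : ℕ) :
    Finite (attempt q₁ q₂ M j).Work := inferInstanceAs (Finite (ι × R))

open Classical in
/-- The distribution of the outcome of a search: it is uniform on the marked items and uniform on
the unmarked ones, with total probabilities that are determined by the angle. -/
theorem ev_attempt (M : R × R → Prop) (j : ℕ) (x : Q → R) (S : Finset ι)
    (hS : ∀ k, k ∈ S ↔ M (item q₁ q₂ x k)) :
    ∃ a b : ENNReal, (∀ g, (attempt q₁ q₂ M j).ev x g =
        a * ∑ k ∈ S, g (item q₁ q₂ x k) + b * ∑ k with k ∉ S, g (item q₁ q₂ x k)) ∧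
      a * S.card = ENNReal.ofReal (Real.sin (3 ^ j * angle ι S) ^ 2) := by
  obtain ⟨a, b, h, ha, hb⟩ := op_iterate_iteration q₁ q₂ M x S hS ((3 ^ j - 1) / 2)
  have hj : (2 * (((3 ^ j - 1) / 2 : ℕ) : ℝ) + 1) = 3 ^ j := by
    have h : (3 ^ j - 1) / 2 * 2 = 3 ^ j - 1 :=
      Nat.div_mul_cancel (by simpa using Nat.sub_dvd_pow_sub_pow 3 1 j)
    have h1 : 1 ≤ 3 ^ j := Nat.one_le_pow _ _ (by norm_num)
    have : 2 * ((3 ^ j - 1) / 2) + 1 = 3 ^ j := by omega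
    exact_mod_cast this
  rw [hj] at ha
  refine ⟨ENNReal.ofReal (a ^ 2), ENNReal.ofReal (b ^ 2), fun g => ?_, ?_⟩
  · set c : ι → ℂ := fun k => ((if k ∈ S then a else b : ℝ) : ℂ) with hc
    have hop : (attemptCircuit q₁ q₂ M j).op x (ket (none, 0, (Classical.arbitrary ι, 0))) =
        ∑ k, c k • ket (loaded q₁ q₂ x k) := by
      rw [attemptCircuit, Circuit.op, Circuit.op, Circuit.op, LinearIsometryEquiv.trans_apply,
        LinearIsometryEquiv.trans_apply]
      have hU := (exists_uniform (Q := Q) (R := R) (Classical.arbitrary ι)).choose_spec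
      change (exists_uniform (Classical.arbitrary ι)).choose
        (ket (none, 0, (Classical.arbitrary ι, 0))) = _ at hU
      rw [hU, h, superposition, map_sum]
      refine Finset.sum_congr rfl fun k _ => ?_
      rw [map_smul, op_load]
    have hcoef : ∀ k, (∑ l, c l • ket (loaded q₁ q₂ x l) : ℓ²(Option Q × R × (ι × R), ℂ))
        (loaded q₁ q₂ x k) = c k := by
      intro k
      rw [lp.coeFn_sum, Finset.sum_apply, Finset.sum_eq_single k]
      · rw [lp.coeFn_smul, Pi.smul_apply, ket_apply_self, smul_eq_mul, mul_one]
      · intro l _ hl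
        rw [lp.coeFn_smul, Pi.smul_apply,
          ket_apply_of_ne ((loaded_injective q₁ q₂ x).ne hl.symm), smul_zero]
      · simp
    have hzero : ∀ b, b ∉ Set.range (loaded q₁ q₂ x) →
        (∑ l, c l • ket (loaded q₁ q₂ x l) : ℓ²(Option Q × R × (ι × R), ℂ)) b = 0 := by
      intro b hb
      rw [lp.coeFn_sum, Finset.sum_apply]
      refine Finset.sum_eq_zero fun l _ => ?_
      rw [lp.coeFn_smul, Pi.smul_apply, ket_apply_of_ne (fun h => hb ⟨l, h.symm⟩), smul_zero]
    have hcn : ∀ k, ‖c k‖ₑ ^ 2 =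
        if k ∈ S then ENNReal.ofReal (a ^ 2) else ENNReal.ofReal (b ^ 2) := by
      intro k
      rw [hc, ← ofReal_norm, ← ENNReal.ofReal_pow (norm_nonneg _), Complex.norm_real,
        Real.norm_eq_abs, sq_abs]
      split_ifs <;> rfl
    rw [attempt, Circuit.ev_toAlgorithm, hop, ← (loaded_injective q₁ q₂ x).tsum_eq, tsum_fintype]
    · simp only [hcoef, hcn]
      rw [← Finset.sum_filter_add_sum_filter_not Finset.univ (fun k => k ∈ S), Finset.mul_sum,
        Finset.mul_sum]
      congr 1
      · rw [Finset.filter_mem_eq_inter, Finset.univ_inter]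
        refine Finset.sum_congr rfl fun k hk => ?_
        rw [if_pos hk]
        rfl
      · refine Finset.sum_congr rfl fun k hk => ?_
        rw [if_neg (Finset.mem_filter.1 hk).2]
        rfl
    · intro b hb
      by_contra hb'
      refine hb ?_
      beta_reduce
      rw [hzero b hb']
      simp
  · rw [← ha, mul_pow, Real.sq_sqrt (by positivity), mul_comm,
      ENNReal.ofReal_mul (by positivity), ENNReal.ofReal_natCast]

end Grover

/-! ### Programs with classical control and a variable running time -/

namespace QueryAlgorithm

variable {Q R O : Type} [AddGroup R]

theorem ev_add (A : QueryAlgorithm Q R O) (x : Q → R) (g g' : O → ENNReal) :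
    A.ev x (fun o => g o + g' o) = A.ev x g + A.ev x g' := by
  rw [ev, ev, ev, ← ENNReal.tsum_add]
  simp only [mul_add]

theorem ev_const_mul (A : QueryAlgorithm Q R O) (x : Q → R) (c : ENNReal) (g : O → ENNReal) :
    A.ev x (fun o => c * g o) = c * A.ev x g := by
  rw [ev, ev, ← ENNReal.tsum_mul_left]
  simp only [mul_left_comm]

end QueryAlgorithm

open Classical in
/-- The indicator of the failure of `p`. -/
def failIndicator (p : Prop) : ENNReal := if p then 0 else 1

theorem failIndicator_of {p : Prop} (h : p) : failIndicator p = 0 := if_pos h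

theorem failIndicator_le_one (p : Prop) : failIndicator p ≤ 1 := by
  unfold failIndicator; split_ifs <;> simp

theorem failIndicator_mono {p p' : Prop} (h : p → p') : failIndicator p' ≤ failIndicator p := by
  unfold failIndicator
  split_ifs with h1 h2 <;> simp_all

/-- A program runs query algorithms one after the other; the next one is selected by the outcomes
of the previous ones. The number of queries may depend on the outcomes. -/
inductive Prog (Q R : Type) [AddGroup R] (O : Type) : Type 1
  /-- The program without queries that returns `o`. -/
  | ret (o : O)
  /-- The program that runs `B` and continues with the program that its outcome selects. -/
  | call {Y : Type} (B : QueryAlgorithm Q R Y) (hB : Finite R → Finite B.Work) (k : Y → Prog Q R O)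

namespace Prog

variable {Q R O O' : Type} [AddGroup R]

/-- The expectation of `g` at the number of queries and the result. -/
def ev (x : Q → R) : Prog Q R O → (ℕ → O → ENNReal) → ENNReal
  | ret o, g => g 0 o
  | call B _ k, g => B.ev x fun y => (k y).ev x fun c o => g (B.queries + c) o

/-- Sequential composition. -/
def bind : Prog Q R O → (O → Prog Q R O') → Prog Q R O'
  | ret o, f => f o
  | call B hB k, f => call B hB fun y => (k y).bind f

theorem ev_mono (x : Q → R) (P : Prog Q R O) {g g' : ℕ → O → ENNReal} (h : ∀ c o, g c o ≤ g' c o) :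
    P.ev x g ≤ P.ev x g' := by
  induction P generalizing g g' with
  | ret o => exact h 0 o
  | call B _ k ih => exact B.ev_mono x fun y => ih y fun c o => h _ o

theorem ev_const (x : Q → R) (P : Prog Q R O) (c : ENNReal) : P.ev x (fun _ _ => c) = c := by
  induction P with
  | ret o => rfl
  | call B _ k ih => simp only [ev, ih, B.ev_const]

theorem ev_le_const (x : Q → R) (P : Prog Q R O) {g : ℕ → O → ENNReal} {ε : ENNReal}
    (h : ∀ c o, g c o ≤ ε) : P.ev x g ≤ ε :=
  (ev_mono x P h).trans (ev_const x P ε).le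

theorem ev_bind (x : Q → R) (P : Prog Q R O) (f : O → Prog Q R O') (g : ℕ → O' → ENNReal) :
    (P.bind f).ev x g = P.ev x fun c o => (f o).ev x fun c' o' => g (c + c') o' := by
  induction P generalizing g with
  | ret o => simp [bind, ev]
  | call B _ k ih => simp only [bind, ev, ih, add_assoc]

theorem ev_add (x : Q → R) (P : Prog Q R O) (g g' : ℕ → O → ENNReal) :
    P.ev x (fun c o => g c o + g' c o) = P.ev x g + P.ev x g' := by
  induction P generalizing g g' with
  | ret o => rfl
  | call B _ k ih => simp only [ev, ih, B.ev_add]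

/-- The union bound: if the first program establishes `p` up to probability `ε`, and the
continuation succeeds up to probability `δ` whenever `p` holds. -/
theorem ev_bind_le (x : Q → R) (P : Prog Q R O) (f : O → Prog Q R O') (p : ℕ → O → Prop)
    (q : ℕ → O' → Prop) {ε δ : ENNReal} (hP : P.ev x (fun c o => failIndicator (p c o)) ≤ ε)
    (hf : ∀ c o, p c o → (f o).ev x (fun c' o' => failIndicator (q (c + c') o')) ≤ δ) :
    (P.bind f).ev x (fun c o => failIndicator (q c o)) ≤ ε + δ := by
  rw [ev_bind]
  calc _ ≤ P.ev x (fun c o => failIndicator (p c o) + δ) := by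
        refine ev_mono x P fun c o => ?_
        by_cases h : p c o
        · exact (hf c o h).trans le_add_self
        · rw [failIndicator, if_neg h]
          exact (ev_le_const x _ fun _ _ => failIndicator_le_one _).trans le_self_add
    _ = P.ev x (fun c o => failIndicator (p c o)) + δ := by rw [ev_add, ev_const]
    _ ≤ ε + δ := by gcongr

/-- A program that is aborted after `N` queries is a query algorithm with exactly `N` queries. -/
theorem exists_queryAlgorithm [Finite Q] [Inhabited O] (P : Prog Q R O) (N : ℕ) :
    ∃ A : QueryAlgorithm Q R O, A.queries = N ∧ (Finite R → Finite A.Work) ∧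
      ∀ (x : Q → R) (p : O → Prop),
        A.ev x (fun o => failIndicator (p o)) ≤
          P.ev x (fun c o => failIndicator (c ≤ N ∧ p o)) := by
  induction P generalizing N with
  | ret o =>
    refine ⟨.const Q R N o, rfl, fun _ => inferInstanceAs (Finite Unit), fun x p => ?_⟩
    rw [QueryAlgorithm.ev_const_algorithm]
    exact failIndicator_mono fun h => h.2
  | call B hB k ih =>
    by_cases hN : B.queries ≤ N
    · choose A hA hfin hev using fun y => ih y (N - B.queries)
      refine ⟨B.bind A (N - B.queries), ?_, fun h => ?_, fun x p => ?_⟩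
      · exact Nat.add_sub_cancel' hN
      · exact QueryAlgorithm.finite_work_bind _ (hB h) fun y => hfin y h
      · rw [QueryAlgorithm.ev_bind hA]
        refine B.ev_mono x fun y => (hev y x p).trans (ev_mono x _ fun c o => ?_)
        exact failIndicator_mono fun h => ⟨by omega, h.2⟩
    · refine ⟨.const Q R N default, rfl, fun _ => inferInstanceAs (Finite Unit), fun x p => ?_⟩
      have h : ∀ c o, failIndicator (B.queries + c ≤ N ∧ p o) = 1 := fun c o => if_neg (by omega)
      simp only [ev, h, ev_const, QueryAlgorithm.ev_const]
      exact (QueryAlgorithm.ev_mono _ x fun o => failIndicator_le_one _).trans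
        (QueryAlgorithm.ev_const _ x 1).le

end Prog

/-! ### The levels of a search -/

namespace Grover

variable {ι Q R : Type} [AddCommGroup R] (q₁ : ι → Q) (q₂ : R → Option Q)
variable [Fintype ι] [Nonempty ι]

theorem ev_attempt_mono (M : R × R → Prop) (j : ℕ) (x : Q → R) {g g' : R × R → ENNReal}
    (h : ∀ k, g (item q₁ q₂ x k) ≤ g' (item q₁ q₂ x k)) :
    (attempt q₁ q₂ M j).ev x g ≤ (attempt q₁ q₂ M j).ev x g' := by
  classical
  obtain ⟨a, b, hev, -⟩ := ev_attempt q₁ q₂ M j x (Finset.univ.filter fun k => M (item q₁ q₂ x k))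
    (by simp)
  rw [hev, hev]
  gcongr <;> exact h _

/-- If a fraction of at least `1 / m` of the marked items is good, so is the outcome with a
probability of at least `1 / m` times the total probability of the marked items. -/
theorem ofReal_sin_sq_le (M : R × R → Prop) (j : ℕ) (x : Q → R) (S : Finset ι)
    (hS : ∀ k, k ∈ S ↔ M (item q₁ q₂ x k)) (good : R × R → Prop) (m : ℕ) (T : Finset ι)
    (hTS : T ⊆ S) (hT : ∀ k ∈ T, good (item q₁ q₂ x k)) (hm : S.card ≤ m * T.card) :
    ENNReal.ofReal (Real.sin (3 ^ j * angle ι S) ^ 2) ≤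
      m * (attempt q₁ q₂ M j).ev x (fun o => failIndicator (¬ good o)) := by
  obtain ⟨a, b, hev, ha⟩ := ev_attempt q₁ q₂ M j x S hS
  rw [hev, ← ha]
  calc a * S.card ≤ a * (m * T.card) := by gcongr; exact_mod_cast hm
    _ = m * (a * T.card) := by ring
    _ ≤ m * (a * ∑ k ∈ S, failIndicator (¬ good (item q₁ q₂ x k))) := by
        gcongr
        calc (T.card : ENNReal) = ∑ k ∈ T, failIndicator (¬ good (item q₁ q₂ x k)) := by
              rw [Finset.card_eq_sum_ones, Nat.cast_sum]
              refine Finset.sum_congr rfl fun k hk => ?_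
              rw [failIndicator, if_neg (not_not.2 (hT k hk))]
              simp
          _ ≤ _ := Finset.sum_le_sum_of_subset hTS
    _ ≤ _ := by gcongr; exact le_self_add

/-- If the outcome of a search is good with a probability of at least `p`, and `g` is at most `δ` at
good items and at most `δ + ε` at all items, then the expectation of `g` is at most
`δ + (1 - p) * ε`. -/
theorem ev_attempt_le (M : R × R → Prop) (j : ℕ) (x : Q → R) {g : R × R → ENNReal}
    (good : R × R → Prop) {p δ ε : ENNReal}
    (hp : p ≤ (attempt q₁ q₂ M j).ev x (fun o => failIndicator (¬ good o)))
    (h₁ : ∀ k, good (item q₁ q₂ x k) → g (item q₁ q₂ x k) ≤ δ)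
    (h₂ : ∀ k, g (item q₁ q₂ x k) ≤ δ + ε) :
    (attempt q₁ q₂ M j).ev x g ≤ δ + (1 - p) * ε := by
  set A := attempt q₁ q₂ M j
  have hadd : A.ev x (fun o => failIndicator (good o)) +
      A.ev x (fun o => failIndicator (¬ good o)) = 1 := by
    rw [← A.ev_add, ← A.ev_const x 1]
    congr 1
    funext o
    unfold failIndicator
    by_cases h : good o <;> simp [h]
  have hle : A.ev x (fun o => failIndicator (good o)) ≤ 1 - p := by
    refine ENNReal.le_sub_of_add_le_right ?_ ?_
    · refine ne_top_of_le_ne_top ENNReal.one_ne_top (hp.trans ?_)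
      rw [← hadd]
      exact le_add_self
    · rw [← hadd]
      gcongr
  calc A.ev x g ≤ A.ev x (fun o => δ + ε * failIndicator (good o)) := by
        refine ev_attempt_mono q₁ q₂ M j x fun k => ?_
        by_cases h : good (item q₁ q₂ x k)
        · exact (h₁ k h).trans le_self_add
        · rw [failIndicator, if_neg h, mul_one]
          exact h₂ k
    _ = δ + ε * A.ev x (fun o => failIndicator (good o)) := by
        rw [A.ev_add, A.ev_const, A.ev_const_mul]
    _ ≤ δ + (1 - p) * ε := by
        rw [mul_comm ε]
        gcongr

theorem angle_nonneg {ι : Type} [Fintype ι] (S : Finset ι) : 0 ≤ angle ι S :=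
  Real.arcsin_nonneg.2 (Real.sqrt_nonneg _)

theorem angle_le_pi_div_two {ι : Type} [Fintype ι] (S : Finset ι) : angle ι S ≤ Real.pi / 2 :=
  Real.arcsin_le_pi_div_two _

theorem angle_mono {S T : Finset ι} (h : S ⊆ T) : angle ι S ≤ angle ι T :=
  Real.monotone_arcsin (Real.sqrt_le_sqrt (by gcongr))

theorem sqrt_le_angle (S : Finset ι) : √(S.card / Fintype.card ι) ≤ angle ι S := by
  rw [← sin_angle]
  exact Real.sin_le (angle_nonneg S)

theorem one_quarter_le_sin_sq {a : ℝ} (h₁ : Real.pi / 6 ≤ a) (h₂ : a ≤ Real.pi / 2) :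
    (1 / 4 : ENNReal) ≤ ENNReal.ofReal (Real.sin a ^ 2) := by
  have h : (1 / 2 : ℝ) ≤ Real.sin a := by
    rw [← Real.sin_pi_div_six]
    exact Real.sin_le_sin_of_le_of_le_pi_div_two (by linarith [Real.pi_pos]) h₂ h₁
  have h4 : (1 / 4 : ENNReal) = ENNReal.ofReal (1 / 4) := by
    rw [ENNReal.ofReal_div_of_pos (by norm_num)]
    simp
  rw [h4]
  exact ENNReal.ofReal_le_ofReal (by nlinarith)

/-- For a non-zero angle some level brings the angle into the range where the probability of the
marked items is at least `1 / 4`. -/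
theorem exists_level {a : ℝ} (h₀ : 0 < a) (h₁ : a ≤ Real.pi / 2) :
    ∃ j : ℕ, Real.pi / 6 ≤ 3 ^ j * a ∧ 3 ^ j * a ≤ Real.pi / 2 := by
  have hex : ∃ j : ℕ, Real.pi / 2 < 3 ^ j * a := by
    obtain ⟨j, hj⟩ := pow_unbounded_of_one_lt (Real.pi / 2 / a) (by norm_num : (1 : ℝ) < 3)
    exact ⟨j, (div_lt_iff₀ h₀).1 hj⟩
  classical
  obtain ⟨j, hj⟩ : ∃ j, Nat.find hex = j + 1 := by
    refine Nat.exists_eq_succ_of_ne_zero fun h => ?_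
    have := Nat.find_spec hex
    rw [h] at this
    linarith
  refine ⟨j, ?_, not_lt.1 (Nat.find_min hex (by omega))⟩
  have := Nat.find_spec hex
  rw [hj, pow_succ] at this
  linarith

/-- The number of queries of searches of the given levels. -/
def levelCost (js : List ℕ) : ℕ := (js.map fun j => 2 * 3 ^ j).sum

@[simp] theorem levelCost_nil : levelCost [] = 0 := rfl

@[simp] theorem levelCost_cons (j : ℕ) (js : List ℕ) :
    levelCost (j :: js) = 2 * 3 ^ j + levelCost js := by simp [levelCost]

@[simp] theorem levelCost_append (js js' : List ℕ) :
    levelCost (js ++ js') = levelCost js + levelCost js' := by simp [levelCost]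

@[simp] theorem levelCost_replicate (s j : ℕ) :
    levelCost (List.replicate s j) = s * (2 * 3 ^ j) := by
  simp [levelCost]

/-- The largest level that is needed for `d` items. -/
def maxLevel (d : ℕ) : ℕ := Nat.log 3 (Nat.sqrt (4 * d))

theorem three_pow_maxLevel_le {d : ℕ} (hd : 0 < d) : (3 ^ maxLevel d : ℝ) ≤ 2 * √d := by
  have h : 3 ^ maxLevel d ≤ Nat.sqrt (4 * d) :=
    Nat.pow_log_le_self 3 (Nat.sqrt_pos.2 (by omega)).ne'
  have h2 : (3 ^ maxLevel d) ^ 2 ≤ 4 * d := by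
    rw [sq]; exact (Nat.mul_le_mul h h).trans (Nat.sqrt_le _)
  have h3 : ((3 ^ maxLevel d : ℝ)) ^ 2 ≤ (2 * √d) ^ 2 := by
    rw [mul_pow, Real.sq_sqrt (by positivity)]
    norm_num
    exact_mod_cast h2
  exact le_of_sq_le_sq h3 (by positivity)

theorem lt_three_pow_maxLevel_succ (d : ℕ) : 2 * √d < (3 ^ (maxLevel d + 1) : ℝ) := by
  have h : Nat.sqrt (4 * d) < 3 ^ (maxLevel d + 1) := Nat.lt_pow_succ_log_self (by norm_num) _
  have h2 : 4 * d < (3 ^ (maxLevel d + 1)) ^ 2 := by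
    rw [sq]; exact Nat.sqrt_lt.1 h
  have h3 : (2 * √d) ^ 2 < ((3 ^ (maxLevel d + 1) : ℝ)) ^ 2 := by
    rw [mul_pow, Real.sq_sqrt (by positivity)]
    norm_num
    exact_mod_cast h2
  exact lt_of_pow_lt_pow_left₀ 2 (by positivity) h3

end Grover

namespace Grover

variable {ι Q R : Type} [AddCommGroup R] (q₁ : ι → Q) (q₂ : R → Option Q)
variable [Fintype ι]
variable {β : Type} [LinearOrder β] (key : R × R → β)

/-- The items with a key above `b`. -/
def above (x : Q → R) (b : WithBot β) : Finset ι :=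
  Finset.univ.filter fun k => b < key (item q₁ q₂ x k)

theorem mem_above (x : Q → R) (b : WithBot β) (k : ι) :
    k ∈ above q₁ q₂ key x b ↔ b < key (item q₁ q₂ x k) := by simp [above]

theorem above_max_subset (x : Q → R) (b c : WithBot β) :
    above q₁ q₂ key x (max b c) ⊆ above q₁ q₂ key x b := fun k hk => by
  rw [mem_above] at hk ⊢
  exact (le_max_left b c).trans_lt hk

/-- Among the items above `b`, at least one ninth have at most one ninth of them above. -/
theorem card_above_le (x : Q → R) (b : WithBot β) :
    (above q₁ q₂ key x b).card ≤ 9 * ((above q₁ q₂ key x b).filter fun k =>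
      9 * (above q₁ q₂ key x (max b (key (item q₁ q₂ x k)))).card ≤
        (above q₁ q₂ key x b).card).card := by
  classical
  set S := above q₁ q₂ key x b
  set T := S.filter fun k => 9 * (above q₁ q₂ key x (max b (key (item q₁ q₂ x k)))).card ≤ S.card
  rcases (S \ T).eq_empty_or_nonempty with h | h
  · have : S ⊆ T := Finset.sdiff_eq_empty_iff_subset.1 h
    have := Finset.card_le_card this
    omega
  · -- All items above an item of `S \ T` with the largest key belong to `T`.
    obtain ⟨k, hk, hmax⟩ := Finset.exists_max_image (S \ T) (fun k => key (item q₁ q₂ x k)) h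
    have hkS := (Finset.mem_sdiff.1 hk).1
    have hsub : above q₁ q₂ key x (max b (key (item q₁ q₂ x k))) ⊆ T := by
      intro l hl
      by_contra hlT
      have hlS : l ∈ S := above_max_subset q₁ q₂ key x _ _ hl
      have := hmax l (Finset.mem_sdiff.2 ⟨hlS, hlT⟩)
      rw [mem_above] at hl
      exact absurd (WithBot.coe_lt_coe.1 ((le_max_right _ _).trans_lt hl)) (not_lt.2 this)
    have hcard := Finset.card_le_card hsub
    have hkT : ¬ 9 * (above q₁ q₂ key x (max b (key (item q₁ q₂ x k)))).card ≤ S.card := fun h' =>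
      (Finset.mem_sdiff.1 hk).2 (Finset.mem_filter.2 ⟨hkS, h'⟩)
    omega

variable [Nonempty ι]

/-! ### Search for a marked item -/

open Classical in
/-- Searches of the given levels, one after the other, until a marked item is found. -/
def search (M : R × R → Prop) : List ℕ → Prog Q R (Option (R × R))
  | [] => .ret none
  | j :: js => .call (attempt q₁ q₂ M j) (fun _ => finite_work_attempt q₁ q₂ M j) fun o =>
    if M o then .ret (some o) else search M js

theorem ev_search_of_forall_not (M : R × R → Prop) (x : Q → R)
    (hM : ∀ k, ¬ M (item q₁ q₂ x k)) (js : List ℕ) :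
    (search q₁ q₂ M js).ev x (fun c o => failIndicator (c = levelCost js ∧ o = none)) = 0 := by
  induction js with
  | nil => exact if_pos ⟨rfl, rfl⟩
  | cons j js ih =>
    rw [search, Prog.ev, queries_attempt, ← nonpos_iff_eq_zero,
      ← QueryAlgorithm.ev_const (attempt q₁ q₂ M j) x 0]
    refine ev_attempt_mono q₁ q₂ M j x fun k => ?_
    rw [if_neg (hM k), ← ih]
    refine Prog.ev_mono x _ fun c o => failIndicator_mono fun h => ⟨?_, h.2⟩
    rw [h.1, levelCost_cons]

/-- If level `j` is suitable for the number of marked items, `s` repetitions of level `j` find a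
marked item up to probability `(3 / 4) ^ s`. -/
theorem ev_search_le (M : R × R → Prop) (x : Q → R) (S : Finset ι)
    (hS : ∀ k, k ∈ S ↔ M (item q₁ q₂ x k)) {j : ℕ} (h₁ : Real.pi / 6 ≤ 3 ^ j * angle ι S)
    (h₂ : 3 ^ j * angle ι S ≤ Real.pi / 2) (s : ℕ) (post pre : List ℕ) (K : ℕ)
    (hK : levelCost (pre ++ List.replicate s j) ≤ K) :
    (search q₁ q₂ M (pre ++ (List.replicate s j ++ post))).ev x
        (fun c o => failIndicator (c ≤ K ∧ ∃ k ∈ S, o = some (item q₁ q₂ x k))) ≤ (3 / 4) ^ s := by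
  -- The step for an arbitrary level; a suitable level contributes the factor `1 - p`.
  have step : ∀ (i : ℕ) (js : List ℕ) (K : ℕ) (p ε : ENNReal), 2 * 3 ^ i ≤ K →
      p ≤ ENNReal.ofReal (Real.sin (3 ^ i * angle ι S) ^ 2) →
      (search q₁ q₂ M js).ev x (fun c o => failIndicator
        (c ≤ K - 2 * 3 ^ i ∧ ∃ k ∈ S, o = some (item q₁ q₂ x k))) ≤ ε →
      (search q₁ q₂ M (i :: js)).ev x (fun c o => failIndicator
        (c ≤ K ∧ ∃ k ∈ S, o = some (item q₁ q₂ x k))) ≤ (1 - p) * ε := by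
    intro i js K p ε hi hp hε
    rw [search, Prog.ev, queries_attempt, ← zero_add ((1 - p) * ε)]
    refine ev_attempt_le q₁ q₂ M i x M (hp.trans ?_) (fun k hk => ?_) fun k => ?_
    · have := ofReal_sin_sq_le q₁ q₂ M i x S hS M 1 S subset_rfl (fun k hk => (hS k).1 hk) (by simp)
      simpa using this
    · rw [if_pos hk, Prog.ev]
      exact (failIndicator_of ⟨by omega, k, (hS k).2 hk, rfl⟩).le
    · by_cases hk : M (item q₁ q₂ x k)
      · rw [if_pos hk, Prog.ev]
        exact (failIndicator_of ⟨by omega, k, (hS k).2 hk, rfl⟩).le.trans zero_le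
      · rw [if_neg hk, zero_add]
        exact (Prog.ev_mono x _ fun c o => failIndicator_mono fun h => ⟨by omega, h.2⟩).trans hε
  induction pre generalizing K with
  | cons i pre ih =>
    rw [List.cons_append, levelCost_cons] at hK
    have := step i (pre ++ (List.replicate s j ++ post)) K 0 _ (by omega) zero_le
      (ih (K - 2 * 3 ^ i) (by omega))
    simpa using this
  | nil =>
    rw [List.nil_append] at hK ⊢
    induction s generalizing K with
    | zero =>
      rw [pow_zero]
      exact Prog.ev_le_const x _ fun _ _ => failIndicator_le_one _
    | succ s ih =>
      rw [List.replicate_succ, levelCost_cons] at hK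
      rw [List.replicate_succ, List.cons_append, pow_succ']
      refine (step j _ K (1 / 4) _ (by omega) (one_quarter_le_sin_sq h₁ h₂)
        (ih (K - 2 * 3 ^ j) (by omega))).trans ?_
      gcongr
      rw [tsub_le_iff_right, ← ENNReal.add_div]
      norm_num
      rw [ENNReal.div_self] <;> norm_num

/-- The schedule for a search: every level below `J` is repeated `s` times. -/
def searchSchedule (s : ℕ) : ℕ → List ℕ
  | 0 => []
  | J + 1 => searchSchedule s J ++ List.replicate s J

theorem levelCost_searchSchedule (s J : ℕ) :
    levelCost (searchSchedule s J) + s = s * 3 ^ J := by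
  induction J with
  | zero => simp [searchSchedule]
  | succ J ih =>
    rw [searchSchedule, levelCost_append, levelCost_replicate, pow_succ]
    linarith

theorem exists_searchSchedule_eq (s : ℕ) {j J : ℕ} (h : j < J) :
    ∃ post, searchSchedule s J = searchSchedule s j ++ (List.replicate s j ++ post) := by
  induction J with
  | zero => omega
  | succ J ih =>
    rcases Nat.lt_succ_iff_lt_or_eq.1 h with h | rfl
    · obtain ⟨post, hp⟩ := ih h
      exact ⟨post ++ List.replicate s J, by rw [searchSchedule, hp]; simp⟩
    · exact ⟨[], by simp [searchSchedule]⟩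

/-- The search for a marked item: up to probability `(3 / 4) ^ s`, it finds one of the `t` marked
items with `O(s √(d / t))` queries, or finds out with `O(s √d)` queries that there are none. -/
theorem ev_search_searchSchedule_le (M : R × R → Prop) (x : Q → R) (S : Finset ι)
    (hS : ∀ k, k ∈ S ↔ M (item q₁ q₂ x k)) (s : ℕ) :
    (search q₁ q₂ M (searchSchedule s (maxLevel (Fintype.card ι) + 1))).ev x
      (fun c o => failIndicator ((c : ℝ) ≤ 6 * s * √(Fintype.card ι / max 1 S.card) ∧
        ((S = ∅ ∧ o = none) ∨ ∃ k ∈ S, o = some (item q₁ q₂ x k)))) ≤ (3 / 4) ^ s := by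
  have hd : 0 < Fintype.card ι := Fintype.card_pos
  rcases S.eq_empty_or_nonempty with rfl | hne
  · refine le_trans (Prog.ev_mono x _ fun c o => failIndicator_mono fun h => ⟨?_, .inl ⟨rfl, h.2⟩⟩)
      ((ev_search_of_forall_not q₁ q₂ M x (fun k => by simp [← hS]) _).le.trans zero_le)
    have h1 : (c : ℝ) + s = s * 3 ^ (maxLevel (Fintype.card ι) + 1) := by
      rw [h.1]
      exact_mod_cast levelCost_searchSchedule s (maxLevel (Fintype.card ι) + 1)
    have h2 := mul_le_mul_of_nonneg_left (three_pow_maxLevel_le hd) (Nat.cast_nonneg (α := ℝ) s)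
    rw [pow_succ] at h1
    rw [Finset.card_empty, max_eq_left zero_le_one, Nat.cast_one, div_one]
    linarith [Nat.cast_nonneg (α := ℝ) s]
  · have ht : (1 : ℝ) ≤ S.card := by exact_mod_cast hne.card_pos
    have hd' : (0 : ℝ) < Fintype.card ι := by exact_mod_cast hd
    have ha : 0 < angle ι S :=
      lt_of_lt_of_le (Real.sqrt_pos.2 (by positivity)) (sqrt_le_angle S)
    obtain ⟨j, h1, h2⟩ := exists_level ha (angle_le_pi_div_two S)
    have h3 : (3 ^ j : ℝ) ≤ 2 * √(Fintype.card ι / S.card) := by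
      have h4 : (3 ^ j : ℝ) * √(S.card / Fintype.card ι) ≤ 2 := by
        have := mul_le_mul_of_nonneg_left (sqrt_le_angle S) (by positivity : (0 : ℝ) ≤ 3 ^ j)
        linarith [Real.pi_le_four]
      have h5 : √((S.card : ℝ) / Fintype.card ι) * √(Fintype.card ι / S.card) = 1 := by
        rw [← Real.sqrt_mul (by positivity), div_mul_div_comm, mul_comm, div_self (by positivity),
          Real.sqrt_one]
      calc (3 ^ j : ℝ) = 3 ^ j * √(S.card / Fintype.card ι) * √(Fintype.card ι / S.card) := by
            rw [mul_assoc, h5, mul_one]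
        _ ≤ _ := by gcongr
    have hj : j < maxLevel (Fintype.card ι) + 1 := by
      have h4 : (3 ^ j : ℝ) < 3 ^ (maxLevel (Fintype.card ι) + 1) := by
        refine lt_of_le_of_lt (h3.trans ?_) (lt_three_pow_maxLevel_succ _)
        gcongr
        exact div_le_self hd'.le ht
      exact (pow_lt_pow_iff_right₀ (by norm_num)).1 h4
    obtain ⟨post, hpost⟩ := exists_searchSchedule_eq s hj
    rw [hpost]
    refine le_trans (Prog.ev_mono x _ fun c o => failIndicator_mono fun h => ⟨?_, .inr h.2⟩)
      (ev_search_le q₁ q₂ M x S hS h1 h2 s post (searchSchedule s j) _ le_rfl)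
    have h6 : (c : ℝ) + s ≤ s * 3 ^ (j + 1) := by
      have := h.1
      have h7 := levelCost_searchSchedule s (j + 1)
      rw [searchSchedule] at h7
      exact_mod_cast (by omega : c + s ≤ s * 3 ^ (j + 1))
    have h8 := mul_le_mul_of_nonneg_left h3 (Nat.cast_nonneg (α := ℝ) s)
    rw [pow_succ] at h6
    rw [max_eq_right (Nat.one_le_cast.1 ht)]
    linarith [Nat.cast_nonneg (α := ℝ) s]

/-! ### Maximum finding -/

/-- Searches of the given levels for items with a key above the largest key `b` found so far. -/
def maxLoop : List ℕ → WithBot β → Prog Q R (WithBot β)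
  | [], b => .ret b
  | j :: js, b => .call (attempt q₁ q₂ (fun o => b < key o) j)
    (fun _ => finite_work_attempt q₁ q₂ _ j) fun o => maxLoop js (max b (key o))

/-- The largest key. -/
def maxKey (x : Q → R) : β :=
  Finset.univ.sup' Finset.univ_nonempty fun k => key (item q₁ q₂ x k)

/-- The probability that `maxLoop` fails to return the largest key. -/
def maxFail (x : Q → R) (js : List ℕ) (b : WithBot β) : ENNReal :=
  (maxLoop q₁ q₂ key js b).ev x fun c o =>
    failIndicator (o = maxKey q₁ q₂ key x ∧ c = levelCost js)

theorem maxFail_le_one (x : Q → R) (js : List ℕ) (b : WithBot β) :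
    maxFail q₁ q₂ key x js b ≤ 1 := Prog.ev_le_const x _ fun _ _ => failIndicator_le_one _

theorem maxFail_cons_le (x : Q → R) (j : ℕ) (js : List ℕ) (b : WithBot β) :
    maxFail q₁ q₂ key x (j :: js) b ≤ (attempt q₁ q₂ (fun o => b < key o) j).ev x
      fun o => maxFail q₁ q₂ key x js (max b (key o)) := by
  rw [maxFail, maxLoop, Prog.ev, queries_attempt]
  refine QueryAlgorithm.ev_mono _ x fun o => Prog.ev_mono x _ fun c o =>
    failIndicator_mono fun h => ⟨h.1, ?_⟩
  rw [h.2, levelCost_cons]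

theorem max_key_le_maxKey (x : Q → R) {b : WithBot β} (hb : b ≤ maxKey q₁ q₂ key x) (k : ι) :
    max b (key (item q₁ q₂ x k)) ≤ maxKey q₁ q₂ key x :=
  max_le hb (WithBot.coe_le_coe.2
    (Finset.le_sup' (fun k => key (item q₁ q₂ x k)) (Finset.mem_univ k)))

theorem three_mul_angle_le {S T : Finset ι} (h : 9 * T.card ≤ S.card) :
    3 * angle ι T ≤ angle ι S := by
  have h0 := angle_nonneg S
  have hpi := angle_le_pi_div_two S
  have hs : Real.sin (angle ι S) ≤ 3 * Real.sin (angle ι S / 3) := by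
    have h1 := Real.sin_three_mul (angle ι S / 3)
    rw [mul_div_cancel₀ _ (by norm_num : (3 : ℝ) ≠ 0)] at h1
    have h2 : 0 ≤ Real.sin (angle ι S / 3) :=
      Real.sin_nonneg_of_nonneg_of_le_pi (by positivity) (by linarith [Real.pi_pos])
    have h3 : 0 ≤ Real.sin (angle ι S / 3) ^ 3 := by positivity
    linarith
  have hle : angle ι T ≤ angle ι S / 3 := by
    rw [angle, Real.arcsin_le_iff_le_sin']
    · have h4 : 3 * √((T.card : ℝ) / Fintype.card ι) ≤ √(S.card / Fintype.card ι) := by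
        refine Real.le_sqrt_of_sq_le ?_
        rw [mul_pow, Real.sq_sqrt (by positivity), ← mul_div_assoc]
        gcongr
        norm_num
        exact_mod_cast h
      rw [← sin_angle S] at h4
      linarith
    · constructor <;> linarith [Real.pi_pos]
  linarith

/-- Further searches never increase the angle. -/
theorem maxFail_replicate_append_le_of_level_succ (x : Q → R) {j : ℕ} {rest : List ℕ} {δ : ENNReal}
    (hrest : ∀ b : WithBot β, b ≤ maxKey q₁ q₂ key x →
      3 ^ (j + 1) * angle ι (above q₁ q₂ key x b) ≤ Real.pi / 2 → maxFail q₁ q₂ key x rest b ≤ δ)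
    (s : ℕ) (b : WithBot β) (hb : b ≤ maxKey q₁ q₂ key x)
    (hl : 3 ^ (j + 1) * angle ι (above q₁ q₂ key x b) ≤ Real.pi / 2) :
    maxFail q₁ q₂ key x (List.replicate s j ++ rest) b ≤ δ := by
  induction s generalizing b with
  | zero => exact hrest b hb hl
  | succ s ih =>
    rw [List.replicate_succ, List.cons_append]
    refine (maxFail_cons_le q₁ q₂ key x j _ b).trans ?_
    rw [← QueryAlgorithm.ev_const (attempt q₁ q₂ (fun o => b < key o) j) x δ]
    refine ev_attempt_mono q₁ q₂ _ j x fun k => ih _ (max_key_le_maxKey q₁ q₂ key x hb k) ?_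
    refine le_trans ?_ hl
    gcongr
    exact angle_mono (above_max_subset q₁ q₂ key x _ _)

/-- Each search of level `j` reduces the angle by a factor `3` with a probability of at least
`1 / 36`, unless the angle is already below the range of this level. -/
theorem maxFail_replicate_append_le (x : Q → R) {j : ℕ} {rest : List ℕ} {δ : ENNReal}
    (hrest : ∀ b : WithBot β, b ≤ maxKey q₁ q₂ key x →
      3 ^ (j + 1) * angle ι (above q₁ q₂ key x b) ≤ Real.pi / 2 → maxFail q₁ q₂ key x rest b ≤ δ)
    (s : ℕ) (b : WithBot β) (hb : b ≤ maxKey q₁ q₂ key x)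
    (hl : 3 ^ j * angle ι (above q₁ q₂ key x b) ≤ Real.pi / 2) :
    maxFail q₁ q₂ key x (List.replicate s j ++ rest) b ≤ δ + (1 - 1 / 36) ^ s := by
  induction s generalizing b with
  | zero =>
    rw [pow_zero]
    exact (maxFail_le_one q₁ q₂ key x _ b).trans le_add_self
  | succ s ih =>
    by_cases hl' : 3 ^ (j + 1) * angle ι (above q₁ q₂ key x b) ≤ Real.pi / 2
    · exact (maxFail_replicate_append_le_of_level_succ q₁ q₂ key x hrest _ b hb hl').trans
        le_self_add
    rw [List.replicate_succ, List.cons_append, pow_succ']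
    refine (maxFail_cons_le q₁ q₂ key x j _ b).trans ?_
    refine ev_attempt_le q₁ q₂ _ j x
      (fun o => 3 ^ (j + 1) * angle ι (above q₁ q₂ key x (max b (key o))) ≤ Real.pi / 2)
      ?_ (fun k hk => ?_) fun k => ?_
    · have h1 : (1 / 4 : ENNReal) ≤ _ := one_quarter_le_sin_sq
        (a := 3 ^ j * angle ι (above q₁ q₂ key x b)) (by rw [pow_succ] at hl'; linarith) hl
      have h2 := h1.trans (ofReal_sin_sq_le q₁ q₂ (fun o => b < key o) j x _
        (mem_above q₁ q₂ key x b)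
        (fun o => 3 ^ (j + 1) * angle ι (above q₁ q₂ key x (max b (key o))) ≤ Real.pi / 2) 9 _
        (Finset.filter_subset _ _) (fun k hk => ?_) (card_above_le q₁ q₂ key x b))
      · rw [mul_comm] at h2
        refine le_trans (le_of_eq ?_) (ENNReal.div_le_of_le_mul h2)
        rw [one_div, one_div, Nat.cast_ofNat, div_eq_mul_inv,
          ← ENNReal.mul_inv (by norm_num) (by norm_num)]
        norm_num
      · have h3 := three_mul_angle_le (Finset.mem_filter.1 hk).2
        have h4 := mul_le_mul_of_nonneg_left h3 (by positivity : (0 : ℝ) ≤ 3 ^ j)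
        rw [pow_succ]
        linarith
    · exact maxFail_replicate_append_le_of_level_succ q₁ q₂ key x hrest s _
        (max_key_le_maxKey q₁ q₂ key x hb k) hk
    · refine ih _ (max_key_le_maxKey q₁ q₂ key x hb k) (le_trans ?_ hl)
      gcongr
      exact angle_mono (above_max_subset q₁ q₂ key x _ _)

/-- The schedule for maximum finding: the levels `j, …, j + i`, where lower levels, being cheaper,
are repeated more often. -/
def maxSchedule (L : ℕ) : ℕ → ℕ → List ℕ
  | j, 0 => List.replicate (25 * L) j
  | j, i + 1 => List.replicate (25 * (L + (i + 1))) j ++ maxSchedule L (j + 1) i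

/-- The cost of the schedule is dominated by its last level. The term with `2 * i` is only needed
for the induction. -/
theorem levelCost_maxSchedule_le (L j i : ℕ) :
    levelCost (maxSchedule L j i) * 2 + 25 * 3 ^ j * (2 * i + (2 * L + 3)) ≤
      25 * 3 ^ (j + i) * (6 * L + 3) := by
  induction i generalizing j with
  | zero =>
    rw [maxSchedule, levelCost_replicate, add_zero]
    apply le_of_eq
    ring
  | succ i ih =>
    have h := ih (j + 1)
    rw [maxSchedule, levelCost_append, levelCost_replicate]
    rw [show j + 1 + i = j + (i + 1) by ring] at h
    have h2 : 0 ≤ 3 ^ j * i := by positivity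
    have h3 : 0 ≤ 3 ^ j * L := by positivity
    rw [pow_succ 3 j] at h
    nlinarith

theorem one_sub_pow_le (n : ℕ) : (1 - 1 / 36 : ENNReal) ^ (25 * n) ≤ (1 / 2) ^ n := by
  have h : (1 - 1 / 36 : ENNReal) = ENNReal.ofReal (35 / 36) := by
    rw [← ENNReal.ofReal_one, show (36 : ENNReal) = ENNReal.ofReal 36 by simp,
      ← ENNReal.ofReal_div_of_pos (by norm_num), ← ENNReal.ofReal_sub _ (by norm_num)]
    norm_num
  have h' : (1 / 2 : ENNReal) = ENNReal.ofReal (1 / 2) := by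
    rw [ENNReal.ofReal_div_of_pos (by norm_num)]
    simp
  rw [pow_mul, h, h', ← ENNReal.ofReal_pow (by norm_num)]
  gcongr
  norm_num

/-- Maximum finding fails with probability at most `2 ^ (1 - L)`. -/
theorem maxFail_maxSchedule_le (x : Q → R) (L i : ℕ) :
    ∀ j, j + i = maxLevel (Fintype.card ι) → ∀ b : WithBot β, b ≤ maxKey q₁ q₂ key x →
      3 ^ j * angle ι (above q₁ q₂ key x b) ≤ Real.pi / 2 →
      maxFail q₁ q₂ key x (maxSchedule L j i) b + (1 / 2) ^ (L + i) ≤ 2 * (1 / 2) ^ L := by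
  have hhalf : ∀ n : ℕ, (1 / 2 : ENNReal) ^ (n + 1) + (1 / 2) ^ (n + 1) = (1 / 2) ^ n := fun n => by
    rw [pow_succ, ← mul_add, one_div, ENNReal.inv_two_add_inv_two, mul_one]
  induction i with
  | zero =>
    intro j hj b hb hl
    have h := maxFail_replicate_append_le q₁ q₂ key x (rest := []) (δ := 0) (fun b hb hl => ?_)
      (25 * L) b hb hl
    · rw [List.append_nil, zero_add] at h
      rw [maxSchedule, add_zero, two_mul]
      gcongr
      exact h.trans (one_sub_pow_le L)
    · -- The angle is less than that of a single item, so no key is above `b`.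
      have hempty : above q₁ q₂ key x b = ∅ := by
        by_contra hne
        have hc : (1 : ℝ) ≤ (above q₁ q₂ key x b).card := by
          exact_mod_cast (Finset.nonempty_iff_ne_empty.2 hne).card_pos
        have hd : (0 : ℝ) < Fintype.card ι := by exact_mod_cast Fintype.card_pos
        have h1 := lt_three_pow_maxLevel_succ (Fintype.card ι)
        rw [show maxLevel (Fintype.card ι) = j by omega] at h1
        have h2 : 1 / √(Fintype.card ι) ≤ angle ι (above q₁ q₂ key x b) := by
          refine le_trans ?_ (sqrt_le_angle _)
          rw [← Real.sqrt_one, ← Real.sqrt_div zero_le_one]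
          gcongr
        have h3 : 2 < (3 ^ (j + 1) : ℝ) * (1 / √(Fintype.card ι)) := by
          rw [mul_one_div, lt_div_iff₀ (Real.sqrt_pos.2 hd)]
          exact h1
        have h4 := mul_le_mul_of_nonneg_left h2 (by positivity : (0 : ℝ) ≤ 3 ^ (j + 1))
        linarith [Real.pi_le_four]
      have hbm : b = maxKey q₁ q₂ key x := by
        refine le_antisymm hb (not_lt.1 fun hlt => ?_)
        obtain ⟨k, -, hk⟩ := Finset.exists_mem_eq_sup' (Finset.univ_nonempty (α := ι))
          fun k => key (item q₁ q₂ x k)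
        have : k ∈ above q₁ q₂ key x b := by
          rw [mem_above, ← hk]
          exact hlt
        simp [hempty] at this
      exact (failIndicator_of ⟨hbm, rfl⟩).le
  | succ i ih =>
    intro j hj b hb hl
    have h := maxFail_replicate_append_le q₁ q₂ key x (rest := maxSchedule L (j + 1) i)
      (δ := 2 * (1 / 2) ^ L - (1 / 2) ^ (L + i)) (fun b hb hl => ?_)
      (25 * (L + (i + 1))) b hb hl
    · rw [maxSchedule]
      calc _ ≤ (2 * (1 / 2) ^ L - (1 / 2) ^ (L + i) + (1 / 2) ^ (L + i + 1)) +
            (1 / 2 : ENNReal) ^ (L + i + 1) := by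
            exact add_le_add (h.trans (add_le_add le_rfl (one_sub_pow_le _))) le_rfl
        _ = 2 * (1 / 2) ^ L := by
            rw [add_assoc, hhalf]
            refine tsub_add_cancel_of_le ?_
            rw [pow_add, mul_comm]
            exact mul_le_mul_left ((pow_le_one₀ zero_le (by simp)).trans one_le_two) _
    · exact ENNReal.le_sub_of_add_le_right (by simp) (ih (j + 1) (by omega) b hb hl)

/-- Maximum finding with `O(L √d)` queries. -/
theorem ev_maxLoop_le (x : Q → R) {L : ℕ} (hL : 1 ≤ L) :
    (maxLoop q₁ q₂ key (maxSchedule L 0 (maxLevel (Fintype.card ι))) ⊥).ev x (fun c o =>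
      failIndicator (o = maxKey q₁ q₂ key x ∧ (c : ℝ) ≤ 225 * L * √(Fintype.card ι))) ≤
      2 * (1 / 2) ^ L := by
  have h := maxFail_maxSchedule_le q₁ q₂ key x L (maxLevel (Fintype.card ι)) 0 (by simp) ⊥ bot_le
    (by rw [pow_zero, one_mul]; exact angle_le_pi_div_two _)
  refine le_trans (Prog.ev_mono x _ fun c o => failIndicator_mono fun h => ⟨h.1, ?_⟩)
    (le_self_add.trans h)
  have h1 := levelCost_maxSchedule_le L 0 (maxLevel (Fintype.card ι))
  rw [← h.2, zero_add] at h1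
  have h2 : (c : ℝ) * 2 ≤ 25 * 3 ^ maxLevel (Fintype.card ι) * (6 * L + 3) := by
    exact_mod_cast (by omega : c * 2 ≤ 25 * 3 ^ maxLevel (Fintype.card ι) * (6 * L + 3))
  have hL' : (1 : ℝ) ≤ L := by exact_mod_cast hL
  have h3 := three_pow_maxLevel_le (d := Fintype.card ι) Fintype.card_pos
  have h4 : (3 ^ maxLevel (Fintype.card ι) : ℝ) * (6 * L + 3) ≤
      2 * √(Fintype.card ι) * (9 * L) := by
    gcongr
    linarith
  linarith

end Grover

/-! ### Transition functions as maxima -/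

/-- All transition functions are functions of a maximum in some linear order, for example `and` is
a function of the disjunction of the negated arguments. -/
theorem Gate.exists_eval_eq_sup' {α : Type} [LinearOrder α] [Zero α] [One α] (h : Gate) :
    ∃ (β : Type) (_ : LinearOrder β) (key : α → β) (out : β → α), ∀ (k : ℕ) (hk : 0 < k)
      (v : Fin k → α),
      h.eval hk v = out (Finset.univ.sup' ⟨⟨0, hk⟩, Finset.mem_univ _⟩ fun j => key (v j)) := by
  classical
  have hbool : ∀ (p : α → Bool) (k : ℕ) (hk : 0 < k) (v : Fin k → α),
      Finset.univ.sup' ⟨⟨0, hk⟩, Finset.mem_univ _⟩ (fun j => p (v j)) = true ↔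
        ∃ j, p (v j) = true := by
    intro p k hk v
    constructor
    · intro h
      obtain ⟨j, -, hj⟩ := Finset.exists_mem_eq_sup' (s := (Finset.univ : Finset (Fin k)))
        ⟨⟨0, hk⟩, Finset.mem_univ _⟩ fun j => p (v j)
      exact ⟨j, hj.symm.trans h⟩
    · rintro ⟨j, hj⟩
      have := Finset.le_sup' (fun j => p (v j)) (Finset.mem_univ j)
      exact this hj
  cases h with
  | and =>
    exact ⟨Bool, inferInstance, fun a => decide (a = 0), fun b => if b = true then 0 else 1,
      fun k hk v => by
        rw [Gate.eval]
        refine (if_congr ?_ rfl rfl).symm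
        exact (hbool (fun a => decide (a = 0)) k hk v).trans (by simp)⟩
  | or =>
    exact ⟨Bool, inferInstance, fun a => decide (a ≠ 0), fun b => if b = true then 1 else 0,
      fun k hk v => by
        rw [Gate.eval]
        refine (if_congr ?_ rfl rfl).symm
        exact (hbool (fun a => decide (a ≠ 0)) k hk v).trans (by simp)⟩
  | nand =>
    exact ⟨Bool, inferInstance, fun a => decide (a = 0), fun b => if b = true then 1 else 0,
      fun k hk v => by
        rw [Gate.eval]
        refine (if_congr ?_ rfl rfl).symm
        exact (hbool (fun a => decide (a = 0)) k hk v).trans (by simp)⟩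
  | max => exact ⟨α, inferInstance, id, id, fun k hk v => rfl⟩
  | min => exact ⟨αᵒᵈ, inferInstance, OrderDual.toDual, OrderDual.ofDual, fun k hk v => rfl⟩

/-! ### Depth-first search -/

namespace DagInput

open Grover

variable {n : ℕ} {d : Fin n → ℕ} {α : Type}

open Classical in
/-- The indices of the out-neighbours of `v` in `U`. -/
def nbrsIn (x : DagInput d α) (U : Finset (Fin n)) (v : Fin n) : Finset (Fin (d v)) :=
  Finset.univ.filter fun k => x.nbr v k ∈ U

theorem mem_nbrsIn (x : DagInput d α) (U : Finset (Fin n)) (v : Fin n) (k : Fin (d v)) :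
    k ∈ x.nbrsIn U v ↔ x.nbr v k ∈ U := by simp [nbrsIn]

theorem card_nbrsIn_mono (x : DagInput d α) {U U' : Finset (Fin n)} (h : U' ⊆ U) (v : Fin n) :
    (x.nbrsIn U' v).card ≤ (x.nbrsIn U v).card :=
  Finset.card_le_card fun k hk => (x.mem_nbrsIn U v k).2 (h ((x.mem_nbrsIn U' v k).1 hk))

theorem card_nbrsIn_erase_lt (x : DagInput d α) {U : Finset (Fin n)} {v : Fin n} {k : Fin (d v)}
    (h : k ∈ x.nbrsIn U v) :
    (x.nbrsIn (U.erase (x.nbr v k)) v).card < (x.nbrsIn U v).card := by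
  refine Finset.card_lt_card ⟨fun l hl => ?_, fun hs => ?_⟩
  · rw [mem_nbrsIn] at hl ⊢
    exact Finset.mem_of_mem_erase hl
  · simpa [mem_nbrsIn] using hs h

/-- The invariant of the depth-first search with the stack `st`, the set `U` of the unvisited
non-sinks and the table `T` of the values computed so far. -/
structure SearchInvariant (x : DagInput d α) (f : Fin n → α) (st : List (Fin n))
    (U : Finset (Fin n)) (T : Fin n → α) : Prop where
  pos_of_mem_stack : ∀ v ∈ st, 0 < d v
  pos_of_mem : ∀ v ∈ U, 0 < d v
  stack_path : st.Pairwise fun a b => Relation.TransGen (fun u v => ∃ k, x.nbr u k = v) b a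
  table_eq : ∀ v, 0 < d v → v ∉ U → v ∉ st → T v = f v

namespace SearchInvariant

variable {x : DagInput d α} {f : Fin n → α} {v : Fin n} {st : List (Fin n)} {U : Finset (Fin n)}
  {T : Fin n → α}

theorem push_root (hi : x.SearchInvariant f [] U T) {u : Fin n} (hu : u ∈ U) :
    x.SearchInvariant f [u] (U.erase u) T where
  pos_of_mem_stack w hw := by
    rw [List.mem_singleton.1 hw]
    exact hi.pos_of_mem u hu
  pos_of_mem w hw := hi.pos_of_mem w (Finset.mem_of_mem_erase hw)
  stack_path := List.pairwise_singleton _ _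
  table_eq w hw hwU hwst := by
    have hwu : w ≠ u := by simpa using hwst
    exact hi.table_eq w hw (fun h => hwU (Finset.mem_erase.2 ⟨hwu, h⟩)) (by simp)

theorem push (hi : x.SearchInvariant f (v :: st) U T) {k : Fin (d v)} (hk : x.nbr v k ∈ U) :
    x.SearchInvariant f (x.nbr v k :: v :: st) (U.erase (x.nbr v k)) T where
  pos_of_mem_stack w hw := by
    rcases List.mem_cons.1 hw with rfl | hw
    · exact hi.pos_of_mem _ hk
    · exact hi.pos_of_mem_stack w hw
  pos_of_mem w hw := hi.pos_of_mem w (Finset.mem_of_mem_erase hw)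
  stack_path := by
    refine List.pairwise_cons.2 ⟨fun w hw => ?_, hi.stack_path⟩
    rcases List.mem_cons.1 hw with rfl | hw
    · exact .single ⟨k, rfl⟩
    · exact .tail ((List.pairwise_cons.1 hi.stack_path).1 w hw) ⟨k, rfl⟩
  table_eq w hw hwU hwst := by
    rw [List.mem_cons, not_or] at hwst
    exact hi.table_eq w hw (fun h => hwU (Finset.mem_erase.2 ⟨hwst.1, h⟩)) hwst.2

/-- When the top vertex of the stack has no unvisited out-neighbours, the values at its
out-neighbours are known: they cannot be on the stack because the graph is acyclic. -/
theorem table_nbr (hi : x.SearchInvariant f (v :: st) U T) (hU : x.nbrsIn U v = ∅) (k : Fin (d v))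
    (hk : 0 < d (x.nbr v k)) : T (x.nbr v k) = f (x.nbr v k) := by
  refine hi.table_eq _ hk (fun h => ?_) fun h => ?_
  · have := (x.mem_nbrsIn U v k).2 h
    simp [hU] at this
  · rcases List.mem_cons.1 h with h | h
    · exact x.acyclic v (.single ⟨k, h⟩)
    · exact x.acyclic v (.head ⟨k, rfl⟩ ((List.pairwise_cons.1 hi.stack_path).1 _ h))

theorem pop (hi : x.SearchInvariant f (v :: st) U T) {a : α} (ha : a = f v) :
    x.SearchInvariant f st U (Function.update T v a) where
  pos_of_mem_stack w hw := hi.pos_of_mem_stack w (List.mem_cons_of_mem _ hw)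
  pos_of_mem := hi.pos_of_mem
  stack_path := (List.pairwise_cons.1 hi.stack_path).2
  table_eq w hw hwU hwst := by
    by_cases hwv : w = v
    · subst hwv
      rw [Function.update_self, ha]
    · rw [Function.update_of_ne hwv]
      exact hi.table_eq w hw hwU (by simp [hwv, hwst])

end SearchInvariant

variable [NeZero n] [AddCommGroup α]

/-- The query of the `k`-th out-neighbour of `v`. -/
def nbrQuery (v : Fin n) (k : Fin (d v)) : DagQuery d := .inl ⟨v, k⟩

/-- The query of the value at a vertex which is the answer to a previous query, if it is a sink. -/
def sinkQuery (z : Fin n × α) : Option (DagQuery d) :=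
  if h : d z.1 = 0 then some (.inr ⟨z.1, h⟩) else none

/-- The value at the vertex of an item, when `T` is a table of the values at the non-sinks. -/
def itemValue (d : Fin n → ℕ) (T : Fin n → α) (o : (Fin n × α) × (Fin n × α)) : α :=
  if d o.1.1 = 0 then o.2.2 else T o.1.1

theorem item_vertex (x : DagInput d α) (v : Fin n) (k : Fin (d v)) :
    (item (nbrQuery v) sinkQuery x.oracle k).1.1 = x.nbr v k := rfl

theorem itemValue_item [LinearOrder α] [One α] {x : DagInput d α} {h : Fin n → Gate} {f : Fin n → α}
    (hf : x.IsDPFunction h f) {T : Fin n → α} (v : Fin n) (k : Fin (d v))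
    (hT : 0 < d (x.nbr v k) → T (x.nbr v k) = f (x.nbr v k)) :
    itemValue d T (item (nbrQuery v) sinkQuery x.oracle k) = f (x.nbr v k) := by
  rw [itemValue, item_vertex]
  split_ifs with h0
  · have : sinkQuery (d := d) (x.oracle (nbrQuery v k)) = some (.inr ⟨x.nbr v k, h0⟩) := dif_pos h0
    rw [item, this]
    exact (hf.1 ⟨_, h0⟩).symm
  · exact hT (Nat.pos_of_ne_zero h0)

/-- The search for an out-neighbour of `v` in `U`, with `3 * L` repetitions of every level. -/
theorem exists_search {v : Fin n} (hv : 0 < d v) (U : Finset (Fin n)) (L : ℕ) :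
    ∃ P : Prog (DagQuery d) (Fin n × α) (Option (Fin n)), ∀ x : DagInput d α,
      P.ev x.oracle (fun c o => failIndicator
        ((c : ℝ) ≤ L * (18 * √(d v / max 1 (x.nbrsIn U v).card)) ∧
          ((x.nbrsIn U v = ∅ ∧ o = none) ∨ ∃ k ∈ x.nbrsIn U v, o = some (x.nbr v k)))) ≤
        (1 / 2) ^ L := by
  have : Nonempty (Fin (d v)) := ⟨⟨0, hv⟩⟩
  refine ⟨(search (nbrQuery v) sinkQuery (fun o => o.1.1 ∈ U)
    (searchSchedule (3 * L) (maxLevel (Fintype.card (Fin (d v))) + 1))).bind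
      fun o => .ret (o.map fun o => o.1.1), fun x => ?_⟩
  have h := ev_search_searchSchedule_le (nbrQuery v) sinkQuery (fun o => o.1.1 ∈ U) x.oracle
    (x.nbrsIn U v) (x.mem_nbrsIn U v) (3 * L)
  rw [Prog.ev_bind]
  refine (Prog.ev_mono _ _ fun c o => failIndicator_mono fun hco => ⟨?_, ?_⟩).trans (h.trans ?_)
  · rw [pow_mul]
    gcongr
    have h34 : (3 / 4 : ENNReal) = ENNReal.ofReal (3 / 4) := by
      rw [ENNReal.ofReal_div_of_pos (by norm_num)]
      simp
    have h12 : (1 / 2 : ENNReal) = ENNReal.ofReal (1 / 2) := by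
      rw [ENNReal.ofReal_div_of_pos (by norm_num)]
      simp
    rw [h34, h12, ← ENNReal.ofReal_pow (by norm_num)]
    exact ENNReal.ofReal_le_ofReal (by norm_num)
  · have := hco.1
    rw [Fintype.card_fin] at this
    push_cast at this ⊢
    linarith
  · rcases hco.2 with ⟨h1, h2⟩ | ⟨k, hk, hk'⟩
    · exact .inl ⟨h1, by rw [h2]; rfl⟩
    · exact .inr ⟨k, hk, by rw [hk']; rfl⟩

variable [LinearOrder α] [One α]

/-- The evaluation of the transition function of `v`, when the values at all out-neighbours of `v`
that are not sinks are known. -/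
theorem exists_evaluation {v : Fin n} (hv : 0 < d v) (h : Fin n → Gate) (T : Fin n → α) {L : ℕ}
    (hL : 1 ≤ L) :
    ∃ P : Prog (DagQuery d) (Fin n × α) α, ∀ (x : DagInput d α) (f : Fin n → α),
      x.IsDPFunction h f →
      (∀ k, 0 < d (x.nbr v k) → T (x.nbr v k) = f (x.nbr v k)) →
      P.ev x.oracle (fun c o => failIndicator (o = f v ∧ (c : ℝ) ≤ L * (225 * √(d v)))) ≤
        2 * (1 / 2) ^ L := by
  have : Nonempty (Fin (d v)) := ⟨⟨0, hv⟩⟩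
  obtain ⟨β, _, key, out, hout⟩ := (h v).exists_eval_eq_sup' (α := α)
  refine ⟨(maxLoop (nbrQuery v) sinkQuery (fun o => key (itemValue d T o))
    (maxSchedule L 0 (maxLevel (Fintype.card (Fin (d v))))) ⊥).bind
      fun b => .ret (WithBot.recBotCoe 0 out b), fun x f hf hT => ?_⟩
  have hmax := ev_maxLoop_le (nbrQuery v) sinkQuery (fun o => key (itemValue d T o)) x.oracle hL
  rw [Prog.ev_bind]
  refine (Prog.ev_mono _ _ fun c b => failIndicator_mono fun hcb => ⟨?_, ?_⟩).trans hmax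
  · rw [hcb.1, hf.2 v hv, hout]
    change out _ = out _
    congr 1
    refine Finset.sup'_congr _ rfl fun k _ => ?_
    exact congrArg key (itemValue_item hf v k (hT k))
  · have := hcb.2
    rw [Fintype.card_fin] at this
    push_cast
    linarith

end DagInput

/-! ### The running time of the depth-first search -/

/-- A bound for the total cost of those searches at a vertex with out-degree `d` which have at most
`t` marked items and cost at least `l`. -/
def searchPotential (l : ℝ) (d t : ℕ) : ℝ := min (2 * √(d * t)) (2 * d / l)

theorem searchPotential_nonneg {l : ℝ} (hl : 0 < l) (d t : ℕ) : 0 ≤ searchPotential l d t :=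
  le_min (by positivity) (by positivity)

theorem searchPotential_mono (l : ℝ) (d : ℕ) {t t' : ℕ} (h : t' ≤ t) :
    searchPotential l d t' ≤ searchPotential l d t := by
  unfold searchPotential
  gcongr

/-- A search with `t` marked items costs at most `l`, or is paid for by the potential. -/
theorem sqrt_div_le_add_searchPotential_sub {l : ℝ} (hl : 0 < l) (d : ℕ) {t t' : ℕ} (h : t' < t) :
    √(d / max 1 t) ≤ l + (searchPotential l d t - searchPotential l d t') := by
  have ht : 1 ≤ t := by omega
  have ht0 : (0 : ℝ) < t := by exact_mod_cast ht
  have hmax : ((max 1 t : ℕ) : ℝ) = t := by rw [max_eq_right ht]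
  have hmono := searchPotential_mono l d h.le
  have hm2 : √((d : ℝ) / max 1 t) = √d / √t := by
    rw [← Real.sqrt_div (by positivity)]
    congr 2
  rw [hm2]
  have hst : 0 < √(t : ℝ) := Real.sqrt_pos.2 ht0
  have hst2 : √(t : ℝ) ^ 2 = t := Real.sq_sqrt ht0.le
  rcases le_total (√(d : ℝ) / √t) l with hle | hle
  · linarith
  · have hdl : √((d : ℝ) * t) ≤ d / l := by
      rw [le_div_iff₀ hl, Real.sqrt_mul (by positivity)]
      rw [le_div_iff₀ hst] at hle
      calc √(d : ℝ) * √t * l = √(d : ℝ) * (l * √t) := by ring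
        _ ≤ √(d : ℝ) * √d := by gcongr
        _ = d := Real.mul_self_sqrt (by positivity)
    have h1 : searchPotential l d t = 2 * (√d * √t) := by
      rw [searchPotential, min_eq_left, Real.sqrt_mul (by positivity)]
      rw [mul_div_assoc]
      linarith
    have h2 : searchPotential l d t' ≤ 2 * (√d * √t') := by
      rw [← Real.sqrt_mul (by positivity)]
      exact min_le_left _ _
    have h3 : √(t' : ℝ) * √t ≤ t - 1 / 2 := by
      have h4 : (t' : ℝ) + 1 ≤ t := by exact_mod_cast h
      have h5 : √(t' : ℝ) ^ 2 = t' := Real.sq_sqrt (by positivity)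
      nlinarith [sq_nonneg (√(t' : ℝ) - √t)]
    have h6 : √(d : ℝ) / √t ≤ 2 * (√d * √t) - 2 * (√d * √t') := by
      rw [div_le_iff₀ hst]
      have := mul_le_mul_of_nonneg_left h3 (Real.sqrt_nonneg (d : ℝ))
      have h7 : (2 * (√(d : ℝ) * √t) - 2 * (√d * √t')) * √t =
          2 * (√d * √t ^ 2) - 2 * (√d * (√t' * √t)) := by ring
      rw [h7, hst2]
      linarith
    linarith

namespace DagInput

variable {n : ℕ} {d : Fin n → ℕ} {α : Type}

/-- The part of the potential of the depth-first search that belongs to the vertex `v`: the cost of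
the evaluation and of the last search, and of the expensive ones among the other searches. -/
def vertexPotential (x : DagInput d α) (l : ℝ) (U : Finset (Fin n)) (v : Fin n) : ℝ :=
  243 * √(d v) + 18 * searchPotential l (d v) (x.nbrsIn U v).card

/-- A bound for the remaining cost of the depth-first search. A vertex in `U` also has to pay for a
search with a cost of at most `l` that finds it. -/
def potential (x : DagInput d α) (l : ℝ) (st : List (Fin n)) (U : Finset (Fin n)) : ℝ :=
  (st.map (x.vertexPotential l U)).sum + ∑ v ∈ U, (x.vertexPotential l U v + 18 * l)

theorem vertexPotential_mono (x : DagInput d α) (l : ℝ) {U U' : Finset (Fin n)} (h : U' ⊆ U)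
    (v : Fin n) : x.vertexPotential l U' v ≤ x.vertexPotential l U v := by
  have := searchPotential_mono l (d v) (x.card_nbrsIn_mono h v)
  unfold vertexPotential
  linarith

theorem vertexPotential_nonneg (x : DagInput d α) {l : ℝ} (hl : 0 < l) (U : Finset (Fin n))
    (v : Fin n) : 0 ≤ x.vertexPotential l U v := by
  have := searchPotential_nonneg hl (d v) (x.nbrsIn U v).card
  unfold vertexPotential
  positivity

theorem potential_nonneg (x : DagInput d α) {l : ℝ} (hl : 0 < l) (st : List (Fin n))
    (U : Finset (Fin n)) : 0 ≤ x.potential l st U := by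
  refine add_nonneg (List.sum_nonneg fun y hy => ?_) (Finset.sum_nonneg fun v _ => ?_)
  · obtain ⟨v, -, rfl⟩ := List.mem_map.1 hy
    exact x.vertexPotential_nonneg hl U v
  · have := x.vertexPotential_nonneg hl U v
    positivity

theorem potential_pop (x : DagInput d α) (l : ℝ) (v : Fin n) (st : List (Fin n))
    (U : Finset (Fin n)) :
    x.potential l (v :: st) U = x.vertexPotential l U v + x.potential l st U := by
  simp only [potential, List.map_cons, List.sum_cons]
  ring

theorem potential_push_le (x : DagInput d α) (l : ℝ) (st : List (Fin n)) {U : Finset (Fin n)}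
    {u : Fin n} (hu : u ∈ U) :
    x.potential l (u :: st) (U.erase u) + 18 * l ≤ x.potential l st U := by
  have hsub : U.erase u ⊆ U := Finset.erase_subset u U
  rw [potential, potential, ← Finset.add_sum_erase U _ hu, List.map_cons, List.sum_cons]
  have h1 : (st.map (x.vertexPotential l (U.erase u))).sum ≤ (st.map (x.vertexPotential l U)).sum :=
    List.sum_le_sum fun v _ => x.vertexPotential_mono l hsub v
  have h2 : ∑ v ∈ U.erase u, (x.vertexPotential l (U.erase u) v + 18 * l) ≤
      ∑ v ∈ U.erase u, (x.vertexPotential l U v + 18 * l) :=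
    Finset.sum_le_sum fun v _ => add_le_add (x.vertexPotential_mono l hsub v) le_rfl
  linarith [x.vertexPotential_mono l hsub u]

/-- The decrease of the potential when an out-neighbour is found pays for the search. -/
theorem potential_push_nbr_le (x : DagInput d α) {l : ℝ} (hl : 0 < l) (v : Fin n)
    (st : List (Fin n)) {U : Finset (Fin n)} {k : Fin (d v)} (hk : k ∈ x.nbrsIn U v) :
    18 * √(d v / max 1 (x.nbrsIn U v).card) +
      x.potential l (x.nbr v k :: v :: st) (U.erase (x.nbr v k)) ≤ x.potential l (v :: st) U := by
  have hu := (x.mem_nbrsIn U v k).1 hk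
  have h1 := x.potential_push_le l st hu
  have h2 := sqrt_div_le_add_searchPotential_sub hl (d v) (x.card_nbrsIn_erase_lt hk)
  have h3 : x.vertexPotential l U v =
    243 * √(d v) + 18 * searchPotential l (d v) (x.nbrsIn U v).card := rfl
  have h4 : x.vertexPotential l (U.erase (x.nbr v k)) v = 243 * √(d v) +
    18 * searchPotential l (d v) (x.nbrsIn (U.erase (x.nbr v k)) v).card := rfl
  simp only [potential_pop] at h1 ⊢
  linarith

/-- The initial potential, with the choice of `l` that balances the two kinds of searches. -/
theorem potential_univ_le (x : DagInput d α) (hn : 0 < numNonSinks d) :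
    x.potential √(numEdges d / numNonSinks d) [] (Finset.univ.filter fun i => 0 < d i) ≤
      297 * √(numNonSinks d * numEdges d) := by
  set U : Finset (Fin n) := Finset.univ.filter fun i => 0 < d i with hU
  have hcard : U.card = numNonSinks d := rfl
  have hsum : ∑ v ∈ U, (d v : ℝ) = numEdges d := by
    rw [numEdges, Nat.cast_sum]
    refine Finset.sum_subset (Finset.subset_univ _) fun v _ hv => ?_
    have : d v = 0 := by simpa [hU] using hv
    simp [this]
  have hN : (0 : ℝ) < numNonSinks d := by exact_mod_cast hn
  have hm : (0 : ℝ) < numEdges d := by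
    rw [← hsum]
    obtain ⟨v, hv⟩ := Finset.card_pos.1 (hcard ▸ hn)
    refine Finset.sum_pos (fun w hw => ?_) ⟨v, hv⟩
    exact_mod_cast (Finset.mem_filter.1 hw).2
  set N : ℝ := (numNonSinks d : ℝ)
  set m : ℝ := (numEdges d : ℝ)
  have hsq : ∑ v ∈ U, √(d v : ℝ) ≤ √(N * m) := by
    refine Real.le_sqrt_of_sq_le ((sq_sum_le_card_mul_sum_sq).trans ?_)
    rw [hcard, ← hsum]
    gcongr with v
    exact (Real.sq_sqrt (by positivity)).le
  have hl : 0 < √(m / N) := Real.sqrt_pos.2 (by positivity)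
  have h1 : N * √(m / N) = √(N * m) := by
    have : N * m = N ^ 2 * (m / N) := by field_simp
    rw [this, Real.sqrt_mul (by positivity), Real.sqrt_sq hN.le]
  have h2 : m / √(m / N) = √(N * m) := by
    rw [← h1, div_eq_iff hl.ne', mul_assoc, Real.mul_self_sqrt (by positivity)]
    field_simp
  have h3 : x.potential √(m / N) [] U ≤
      ∑ v ∈ U, (243 * √(d v : ℝ) + 18 * (2 * d v / √(m / N)) + 18 * √(m / N)) := by
    rw [potential, List.map_nil, List.sum_nil, zero_add]
    refine Finset.sum_le_sum fun v _ => ?_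
    have : searchPotential √(m / N) (d v) (x.nbrsIn U v).card ≤ 2 * d v / √(m / N) :=
      min_le_right _ _
    rw [vertexPotential]
    linarith
  refine h3.trans ?_
  rw [Finset.sum_add_distrib, Finset.sum_add_distrib, ← Finset.mul_sum, ← Finset.mul_sum,
    ← Finset.sum_div, ← Finset.mul_sum, hsum, Finset.sum_const, hcard, nsmul_eq_mul, mul_div_assoc,
    h2]
  change 243 * _ + 18 * (2 * √(N * m)) + N * (18 * √(m / N)) ≤ _
  linarith

end DagInput

/-! ### The algorithm -/

namespace DagInput

variable {n : ℕ} [NeZero n] {d : Fin n → ℕ} {α : Type} [AddCommGroup α] [LinearOrder α] [One α]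

/-- The depth-first search. The number of steps is bounded by `fuel`, since every step moves a
vertex onto the stack or off it. Every step fails with probability at most `3 / 2 ^ L`. -/
theorem exists_depthFirstSearch (h : Fin n → Gate) {L : ℕ} (hL : 1 ≤ L) (fuel : ℕ) :
    ∀ (st : List (Fin n)) (U : Finset (Fin n)) (T : Fin n → α),
      ∃ P : Prog (DagQuery d) (Fin n × α) (Fin n → α), ∀ (x : DagInput d α) (f : Fin n → α) (l : ℝ),
        x.IsDPFunction h f → x.SearchInvariant f st U T → 2 * U.card + st.length ≤ fuel → 0 < l →
        P.ev x.oracle (fun c o => failIndicator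
          ((∀ v, 0 < d v → o v = f v) ∧ (c : ℝ) ≤ L * x.potential l st U)) ≤
          fuel * (3 * (1 / 2) ^ L) := by
  induction fuel with
  | zero =>
    refine fun st U T => ⟨.ret T, fun x f l hf hi hcard hl => ?_⟩
    have hU : U = ∅ := Finset.card_eq_zero.1 (by omega)
    have hst : st = [] := List.length_eq_zero_iff.1 (by omega)
    refine (failIndicator_of ⟨fun v hv => ?_, ?_⟩).le.trans zero_le
    · exact hi.table_eq v hv (by simp [hU]) (by simp [hst])
    · have := x.potential_nonneg hl st U
      rw [Nat.cast_zero]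
      positivity
  | succ fuel ih =>
    intro st U T
    cases st with
    | nil =>
      rcases U.eq_empty_or_nonempty with rfl | hne
      · refine ⟨.ret T, fun x f l hf hi hcard hl => ?_⟩
        refine (failIndicator_of ⟨fun v hv => ?_, ?_⟩).le.trans zero_le
        · exact hi.table_eq v hv (by simp) (by simp)
        · have := x.potential_nonneg hl [] ∅
          rw [Nat.cast_zero]
          positivity
      · obtain ⟨u, hu⟩ := hne
        obtain ⟨P, hP⟩ := ih [u] (U.erase u) T
        refine ⟨P, fun x f l hf hi hcard hl => ?_⟩
        have hc := Finset.card_erase_add_one hu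
        refine (Prog.ev_mono _ _ fun c o => failIndicator_mono fun ho => ⟨ho.1, ?_⟩).trans
          ((hP x f l hf (hi.push_root hu) ?_ hl).trans ?_)
        · simp only [List.length_nil, List.length_singleton] at hcard ⊢
          omega
        · gcongr
          omega
        · refine ho.2.trans ?_
          have := x.potential_push_le l [] hu
          gcongr
          linarith
    | cons v st =>
      by_cases hv : 0 < d v
      swap
      · exact ⟨.ret T, fun x f l hf hi => absurd (hi.pos_of_mem_stack v List.mem_cons_self) hv⟩
      obtain ⟨S, hS⟩ := exists_search (α := α) hv U L
      obtain ⟨E, hE⟩ := exists_evaluation hv h T hL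
      choose P hP using fun u => ih (u :: v :: st) (U.erase u) T
      choose P' hP' using fun a => ih st U (Function.update T v a)
      refine ⟨S.bind fun o => o.elim (E.bind P') P, fun x f l hf hi hcard hl => ?_⟩
      rw [List.length_cons] at hcard
      have hpot := x.potential_nonneg hl
      have hbound : (1 / 2 : ENNReal) ^ L + (2 * (1 / 2) ^ L + fuel * (3 * (1 / 2) ^ L)) =
          ((fuel + 1 : ℕ) : ENNReal) * (3 * (1 / 2) ^ L) := by
        push_cast
        ring
      rw [← hbound]
      refine Prog.ev_bind_le x.oracle S _ _ _ (hS x) fun c o hco => ?_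
      obtain ⟨hc, ⟨hemp, rfl⟩ | ⟨k, hk, rfl⟩⟩ := hco
      · have hcost : 18 * √((d v : ℝ) / max 1 (x.nbrsIn U v).card) + 225 * √(d v) +
            x.potential l st U ≤ x.potential l (v :: st) U := by
          rw [potential_pop, vertexPotential, hemp, Finset.card_empty, max_eq_left zero_le_one,
            Nat.cast_one, div_one]
          linarith [searchPotential_nonneg hl (d v) 0]
        refine Prog.ev_bind_le x.oracle E P' _ _ (hE x f hf (hi.table_nbr hemp)) fun c' a hca => ?_
        refine (Prog.ev_mono _ _ fun c'' o => failIndicator_mono fun ho => ⟨ho.1, ?_⟩).trans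
          (hP' a x f l hf (hi.pop hca.1) (by omega) hl)
        have := mul_le_mul_of_nonneg_left hcost (Nat.cast_nonneg (α := ℝ) L)
        push_cast
        linarith [ho.2, hca.2]
      · have hu := (x.mem_nbrsIn U v k).1 hk
        have hcost := x.potential_push_nbr_le hl v st hk
        have hc' := Finset.card_erase_add_one hu
        refine (Prog.ev_mono _ _ fun c' o => failIndicator_mono fun ho => ⟨ho.1, ?_⟩).trans
          ((hP (x.nbr v k) x f l hf (hi.push hu) ?_ hl).trans le_add_self)
        · simp only [List.length_cons]
          omega
        · have := mul_le_mul_of_nonneg_left hcost (Nat.cast_nonneg (α := ℝ) L)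
          push_cast
          linarith [ho.2]

end DagInput

open Classical in
theorem QueryAlgorithm.prob_eq_toReal_ev_failIndicator {Q R O : Type} [AddGroup R]
    (A : QueryAlgorithm Q R O) (x : Q → R) (p : O → Prop) :
    A.prob x (fun o => ¬ p o) = (A.ev x fun o => failIndicator (p o)).toReal := by
  rw [A.prob_eq_toReal_ev]
  congr 2
  funext o
  unfold failIndicator
  split_ifs <;> simp_all

/-- The number of repetitions `2 ⌈log₂ N⌉` is at most `6 log N`. -/
theorem two_mul_clog_le {N : ℕ} (hN : 2 ≤ N) : ((2 * Nat.clog 2 N : ℕ) : ℝ) ≤ 6 * Real.log N := by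
  have hlog : Real.log 2 ≤ Real.log N := Real.log_le_log (by norm_num) (by exact_mod_cast hN)
  have hpos : 0 < Nat.clog 2 N := Nat.clog_pos (by norm_num) hN
  have hlt : 2 ^ (Nat.clog 2 N - 1) < N := by
    have := Nat.pow_pred_clog_lt_self (b := 2) (by norm_num) (x := N) (by omega)
    simpa using this
  have h1 : ((Nat.clog 2 N - 1 : ℕ) : ℝ) * Real.log 2 ≤ Real.log N := by
    rw [← Real.log_pow]
    exact Real.log_le_log (by positivity) (by exact_mod_cast hlt.le)
  rw [Nat.cast_sub (by omega)] at h1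
  push_cast at h1 ⊢
  have h2 := Real.log_two_gt_d9
  have h3 : (0 : ℝ) < Nat.clog 2 N := by exact_mod_cast hpos
  nlinarith

theorem lemma5 :
    ∃ C : ℝ, 0 < C ∧
      ∀ (n : ℕ) [NeZero n] (d : Fin n → ℕ) (α : Type) [LinearOrder α] [AddCommGroup α] [One α]
        (h : Fin n → Gate), 0 < numNonSinks d →
        ∃ A : QueryAlgorithm (DagQuery d) (Fin n × α) ({i // 0 < d i} → α),
          (Finite α → Finite A.Work) ∧
          (A.queries : ℝ) ≤
            C * (Real.sqrt (numNonSinks d * numEdges d) * Real.log (numNonSinks d)) ∧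
          (A.queries : ℝ) ≤ C * (Real.sqrt (n * numEdges d) * Real.log n) ∧
          ∀ (x : DagInput d α) (f : Fin n → α), x.IsDPFunction h f →
            A.prob x.oracle (fun t => ¬ ∀ i, t i = f i) ≤ C / numNonSinks d := by
  refine ⟨1782, by norm_num, fun n _ d α _ _ _ h hN => ?_⟩
  have hNn : numNonSinks d ≤ n := (Finset.card_filter_le _ _).trans (by simp)
  have hN0 : (0 : ℝ) < numNonSinks d := by exact_mod_cast hN
  have hlog0 : 0 ≤ Real.log (numNonSinks d) := Real.log_nonneg (by exact_mod_cast hN)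
  -- The second bound for the running time follows from the first one.
  suffices hA : ∃ A : QueryAlgorithm (DagQuery d) (Fin n × α) ({i // 0 < d i} → α),
      (Finite α → Finite A.Work) ∧
      (A.queries : ℝ) ≤
        1782 * (Real.sqrt (numNonSinks d * numEdges d) * Real.log (numNonSinks d)) ∧
      ∀ (x : DagInput d α) (f : Fin n → α), x.IsDPFunction h f →
        A.prob x.oracle (fun t => ¬ ∀ i, t i = f i) ≤ 1782 / numNonSinks d by
    obtain ⟨A, h1, h2, h3⟩ := hA
    refine ⟨A, h1, h2, h2.trans ?_, h3⟩
    gcongr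
  rcases Nat.lt_or_ge 1 (numNonSinks d) with hN2 | hN1
  · set L := 2 * Nat.clog 2 (numNonSinks d) with hL
    have hL1 : 1 ≤ L := by
      have : 0 < Nat.clog 2 (numNonSinks d) := Nat.clog_pos (by norm_num) hN2
      omega
    obtain ⟨P, hP⟩ := DagInput.exists_depthFirstSearch (α := α) h hL1 (2 * numNonSinks d) []
      (Finset.univ.filter fun i => 0 < d i) 0
    have : Inhabited ({i // 0 < d i} → α) := ⟨0⟩
    obtain ⟨A, hq, hfin, hA⟩ :=
      (P.bind fun t => .ret fun i : {i // 0 < d i} => t i).exists_queryAlgorithm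
        ⌊297 * L * √(numNonSinks d * numEdges d)⌋₊
    refine ⟨A, fun _ => hfin inferInstance, ?_, fun x f hf => ?_⟩
    · rw [hq]
      refine (Nat.floor_le (by positivity)).trans ?_
      have := mul_le_mul_of_nonneg_left (two_mul_clog_le hN2)
        (Real.sqrt_nonneg (numNonSinks d * numEdges d : ℝ))
      linarith
    · have hm : 0 < numEdges d := by
        obtain ⟨v, hv⟩ := Finset.card_pos.1 hN
        exact (Finset.mem_filter.1 hv).2.trans_le (Finset.single_le_sum (fun _ _ => Nat.zero_le _)
          (Finset.mem_univ v))
      have hm0 : (0 : ℝ) < numEdges d := by exact_mod_cast hm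
      have hi : x.SearchInvariant f [] (Finset.univ.filter fun i => 0 < d i) 0 :=
        ⟨by simp, by simp, List.Pairwise.nil, fun v hv hvU => absurd hv (by simpa using hvU)⟩
      have hev := hP x f √(numEdges d / numNonSinks d) hf hi (by simp [numNonSinks])
        (Real.sqrt_pos.2 (by positivity))
      have hfail : A.ev x.oracle (fun t => failIndicator (∀ i, t i = f i)) ≤
          ENNReal.ofReal (6 / numNonSinks d) := by
        refine (hA x.oracle _).trans ?_
        rw [Prog.ev_bind]
        refine (Prog.ev_mono _ _ fun c o => failIndicator_mono fun ho => ⟨?_, ?_⟩).trans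
          (hev.trans ?_)
        · have h2 : (1 / 2 : ENNReal) ^ L = ENNReal.ofReal ((1 / 2) ^ L) := by
            rw [ENNReal.ofReal_pow (by norm_num), ENNReal.ofReal_div_of_pos (by norm_num)]
            simp
          have h3 : (((2 * numNonSinks d : ℕ) : ENNReal)) * (3 * ENNReal.ofReal ((1 / 2) ^ L)) =
              ENNReal.ofReal (2 * numNonSinks d * (3 * (1 / 2) ^ L)) := by
            rw [ENNReal.ofReal_mul (by positivity), ENNReal.ofReal_mul (by norm_num)]
            congr 1
            · rw [← ENNReal.ofReal_natCast, Nat.cast_mul, Nat.cast_ofNat,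
                ENNReal.ofReal_mul (by norm_num)]
            · simp
          rw [h2, h3]
          refine ENNReal.ofReal_le_ofReal ?_
          have h4 : (numNonSinks d : ℝ) ≤ 2 ^ Nat.clog 2 (numNonSinks d) := by
            exact_mod_cast Nat.le_pow_clog (by norm_num) _
          have h5 : (1 / 2 : ℝ) ^ L ≤ 1 / (numNonSinks d) ^ 2 := by
            rw [hL, mul_comm, pow_mul, one_div_pow, ← one_div_pow _ 2]
            gcongr
          calc 2 * (numNonSinks d : ℝ) * (3 * (1 / 2) ^ L)
              ≤ 2 * (numNonSinks d : ℝ) * (3 * (1 / (numNonSinks d) ^ 2)) := by gcongr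
            _ = 6 / numNonSinks d := by field_simp; norm_num
        · refine Nat.le_floor (ho.2.trans ?_)
          have := mul_le_mul_of_nonneg_left (x.potential_univ_le hN) (Nat.cast_nonneg (α := ℝ) L)
          linarith
        · exact fun i => ho.1 i i.2
      rw [QueryAlgorithm.prob_eq_toReal_ev_failIndicator]
      refine (ENNReal.toReal_le_of_le_ofReal (by positivity) hfail).trans ?_
      gcongr
      norm_num
  · -- For a single non-sink the logarithm vanishes, and the bound for the probability is trivial.
    have hN' : numNonSinks d = 1 := by omega
    refine ⟨.const _ _ 0 0, fun _ => inferInstanceAs (Finite Unit), ?_, fun x f hf => ?_⟩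
    · change ((0 : ℕ) : ℝ) ≤ _
      rw [Nat.cast_zero]
      positivity
    · rw [QueryAlgorithm.prob_eq_toReal_ev_failIndicator, QueryAlgorithm.ev_const_algorithm, hN']
      refine (ENNReal.toReal_mono ENNReal.one_ne_top (failIndicator_le_one _)).trans ?_
      norm_num

end
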